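/- Let $M$ be a smooth $(n+1)$-dimensional manifold fibred over $\mathbb R$ by a surjective submersion $\pi:M\to\mathbb R$, and let $J^1\pi$ be its first jet bundle, with projection $\pi_{10}:J^1\pi\to M$ and induced local coordinates $(t,x^i,y^i)$. Let $J=\frac{\partial}{\partial y^i}\otimes(dx^i-y^i\,dt)$ be the vertical endomorphism. A *semispray* is a smooth vector field $S$ on $J^1\pi$ with $J(S)=0$ and $dt(S)=1$. Let $U\subset J^1\pi$ be open. * A smooth 1-form $\theta$ on $U$ is *semi-basic* if it vanishes on $\ker D\pi_{10}$, and a semi-basic $\theta$ is *non-degenerate* (with respect to $S$) if the 2-form $d\theta+i_Sd\theta\wedge dt$ has rank $2n$ at every point of $U$. * For a smooth function $L$ on $U$ (a Lagrangian) put $\theta_L=L\,dt+dL\circ J$; $L$ is *regular* if $d\theta_L$ has rank $2n$ at every point of $U$. * $S$ is *Lagrangian over* an open set $W\subset J^1\pi$ if every point of $W$ has an open neighbourhood on which there is a regular Lagrangian $L$ with $\mathcal L_S\theta_L=dL$; and $S$ is a *Lagrangian vector field* if it is Lagrangian over $J^1\pi$. Theorem. Let $S$ be a semispray on $J^1\pi$.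 1. $S$ is a Lagrangian vector field if and only if every point of $J^1\pi$ has an open neighbourhood on which there is a non-degenerate semi-basic 1-form $\theta$ with $\mathcal L_S\theta$ closed. 2. For every open $W\subset J^1\pi$ (in particular $W=J^1\pi$): if there is a non-degenerate semi-basic 1-form $\theta$ on $W$ with $\mathcal L_S\theta$ closed, then $S$ is Lagrangian over $W$. 3. For every open $W\subset J^1\pi$ (in particular $W=J^1\pi$): if there is a regular Lagrangian $L$ on $W$ with $\mathcal L_S\theta_L=dL$, then there is a non-degenerate semi-basic 1-form $\theta$ on $W$ with $\mathcal L_S\theta$ closed. -/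

import Mathlib

open scoped Manifold ContDiff Topology

noncomputable section

namespace JetBundle

open Set

abbrev Euc (n : ℕ) : Type := EuclideanSpace ℝ (Fin n)

/-- The model space `(t, x)` of the fibred manifold `M`. -/
abbrev BaseModel (n : ℕ) : Type := ℝ × Euc n

/-- The model space `((t, x), y)` of `J¹π`. -/
abbrev JetModel (n : ℕ) : Type := BaseModel n × Euc n

section
variable {n : ℕ} {M : Type*} [TopologicalSpace M] [ChartedSpace (Euc (n + 1)) M]

/-- `π : M → ℝ` makes the `(n + 1)`-dimensional manifold `M` a fibred manifold over `ℝ`: it is a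
surjective smooth submersion. -/
class IsFibred (n : ℕ) {M : Type*} [TopologicalSpace M] [ChartedSpace (Euc (n + 1)) M] (π : M → ℝ) : Prop where
  isSubmersion : Manifold.IsSubmersion (𝓡 (n + 1)) 𝓘(ℝ, ℝ) ∞ π
  surjective : Function.Surjective π

/-- Smooth local coordinates `(t, xⁱ)` on `M` whose first coordinate is `π`. -/
structure IsAdapted (π : M → ℝ) (φ : OpenPartialHomeomorph M (BaseModel n)) : Prop where
  contMDiffOn : ContMDiffOn (𝓡 (n + 1)) 𝓘(ℝ, BaseModel n) ∞ φ φ.source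
  contMDiffOn_symm : ContMDiffOn 𝓘(ℝ, BaseModel n) (𝓡 (n + 1)) ∞ φ.symm φ.target
  fst_eq : ∀ p ∈ φ.source, (φ p).1 = π p

theorem exists_isAdapted [IsManifold (𝓡 (n + 1)) ∞ M] (π : M → ℝ) [h : IsFibred n π] (p : M) :
    ∃ φ : OpenPartialHomeomorph M (BaseModel n), IsAdapted π φ ∧ p ∈ φ.source := by
  obtain ⟨F, _, _, hF⟩ := h.isSubmersion
  specialize hF p
  have : FiniteDimensional ℝ (ℝ × F) := hF.equiv.toLinearEquiv.finiteDimensional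
  have : FiniteDimensional ℝ F := Module.Finite.of_surjective (LinearMap.snd ℝ ℝ F)
    LinearMap.snd_surjective
  have hfin : Module.finrank ℝ F = n := by
    have := hF.equiv.toLinearEquiv.finrank_eq
    simp at this
    omega
  let a : F ≃L[ℝ] Euc n := ContinuousLinearEquiv.ofFinrankEq (by simp [hfin])
  let b : Euc (n + 1) ≃L[ℝ] BaseModel n :=
    hF.equiv.trans ((ContinuousLinearEquiv.refl ℝ ℝ).prodCongr a)
  let ψ := hF.codChart
  have hψ := hF.codChart_mem_maximalAtlas
  have hφ := hF.domChart_mem_maximalAtlas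
  let c : OpenPartialHomeomorph (BaseModel n) (BaseModel n) :=
    ψ.symm.prod (OpenPartialHomeomorph.refl (Euc n))
  have key : ∀ q ∈ hF.domChart.source, (b (hF.domChart q)).1 = ψ (π q) := by
    intro q hq
    have hq' : hF.domChart q ∈ (hF.domChart.extend (𝓡 (n + 1))).target := by
      simpa using hF.domChart.map_source hq
    have := hF.writtenInCharts hq'
    simp [hF.domChart.left_inv hq] at this
    simp [b, ψ, this]
  have key2 : ∀ q ∈ hF.domChart.source, π q ∈ ψ.source := hF.mapsto_domChart_source_codChart_source
  let φ := hF.domChart.trans (b.toHomeomorph.toOpenPartialHomeomorph.trans c)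
  have hsrc : ∀ q, q ∈ φ.source ↔ q ∈ hF.domChart.source := by
    intro q
    simp only [φ, c, OpenPartialHomeomorph.trans_source, mem_inter_iff, mem_preimage]
    constructor
    · exact fun h => h.1
    · intro hq
      refine ⟨hq, ?_⟩
      simp
      rw [key q hq]
      exact ψ.map_source (key2 q hq)
  have hc : ContMDiffOn 𝓘(ℝ, BaseModel n) 𝓘(ℝ, BaseModel n) ∞ c c.source := by
    have h1 := contMDiffOn_symm_of_mem_maximalAtlas hψ
    rw [contMDiffOn_iff_contDiffOn] at h1 ⊢
    exact (h1.comp contDiff_fst.contDiffOn (fun x hx => by simpa [c] using hx)).prodMk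
      contDiff_snd.contDiffOn
  have hc' : ContMDiffOn 𝓘(ℝ, BaseModel n) 𝓘(ℝ, BaseModel n) ∞ c.symm c.target := by
    have h1 := contMDiffOn_of_mem_maximalAtlas hψ
    rw [contMDiffOn_iff_contDiffOn] at h1 ⊢
    exact (h1.comp contDiff_fst.contDiffOn (fun x hx => by simpa [c] using hx)).prodMk
      contDiff_snd.contDiffOn
  refine ⟨φ, ⟨?_, ?_, ?_⟩, ?_⟩
  · refine hc.comp (b.contDiff.contMDiff.comp_contMDiffOn
      ((contMDiffOn_of_mem_maximalAtlas hφ).mono fun q hq => (hsrc q).1 hq)) ?_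
    intro q hq
    simpa [φ, OpenPartialHomeomorph.trans_source] using hq.2
  · refine (contMDiffOn_symm_of_mem_maximalAtlas hφ).comp
      (b.symm.contDiff.contMDiff.comp_contMDiffOn (hc'.mono ?_)) ?_
    · intro z hz
      simp [φ] at hz
      exact hz.1
    · intro z hz
      simp [φ] at hz
      exact hz.2
  · intro q hq
    have hq' := (hsrc q).1 hq
    change ψ.symm (b (hF.domChart q)).1 = π q
    rw [key q hq', ψ.left_inv (key2 q hq')]
  · exact (hsrc p).2 hF.mem_domChart_source

variable {E : Type*} [NormedAddCommGroup E] [NormedSpace ℝ E]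
  {N : Type*} [TopologicalSpace N] [ChartedSpace E N]
  {V : Type*} [NormedAddCommGroup V] [NormedSpace ℝ V]

/-- The differential of a map into a vector space. For a function `f : N → ℝ` it is the 1-form `df`. -/
def differential (f : N → V) (u : N) : TangentSpace 𝓘(ℝ, E) u →L[ℝ] V :=
  mfderiv 𝓘(ℝ, E) 𝓘(ℝ, V) f u

/-- The differential of a map from a vector space to a manifold. -/
def tangentParam (γ : V → N) (z : V) : V →L[ℝ] TangentSpace 𝓘(ℝ, E) (γ z) :=
  mfderiv 𝓘(ℝ, V) 𝓘(ℝ, E) γ z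

variable (n) in
/-- The first jet bundle `J¹π`. The jet `j¹_t γ` of a local section `γ` of `π` is determined by
`γ(t)` and `γ'(t)`, and the vectors `γ'(t)` are the tangent vectors `v` of `M` with `dπ(v) = 1`. -/
def J1 (π : M → ℝ) : Type _ :=
  {v : TangentBundle (𝓡 (n + 1)) M // differential π v.proj v.snd = 1}

variable {π : M → ℝ}

/-- The projection `π₁₀ : J¹π → M`. -/
def J1.pt (u : J1 n π) : M := u.1.proj

/-- The velocity `γ'(t)` of the jet `j¹_t γ`. -/
def J1.vel (u : J1 n π) : TangentSpace (𝓡 (n + 1)) u.pt := u.1.snd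

namespace IsAdapted
variable {φ : OpenPartialHomeomorph M (BaseModel n)}

theorem mdifferentiableAt (h : IsAdapted π φ) {p : M} (hp : p ∈ φ.source) :
    MDifferentiableAt (𝓡 (n + 1)) 𝓘(ℝ, BaseModel n) φ p :=
  (h.contMDiffOn.contMDiffAt (φ.open_source.mem_nhds hp)).mdifferentiableAt (by simp)

theorem mdifferentiableAt_symm (h : IsAdapted π φ) {z : BaseModel n} (hz : z ∈ φ.target) :
    MDifferentiableAt 𝓘(ℝ, BaseModel n) (𝓡 (n + 1)) φ.symm z :=
  (h.contMDiffOn_symm.contMDiffAt (φ.open_target.mem_nhds hz)).mdifferentiableAt (by simp)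

theorem tangentParam_differential (h : IsAdapted π φ) {p : M} (hp : p ∈ φ.source)
    (v : TangentSpace (𝓡 (n + 1)) p) :
    tangentParam (E := Euc (n + 1)) φ.symm (φ p) (differential φ p v) = v := by
  have h1 := mfderiv_comp p (h.mdifferentiableAt_symm (φ.map_source hp)) (h.mdifferentiableAt hp)
  have h2 : (φ.symm ∘ φ) =ᶠ[𝓝 p] id := by
    filter_upwards [φ.open_source.mem_nhds hp] with q hq using φ.left_inv hq
  rw [h2.mfderiv_eq, mfderiv_id] at h1
  exact (DFunLike.congr_fun h1 v).symm

theorem differential_tangentParam (h : IsAdapted π φ) {z : BaseModel n} (hz : z ∈ φ.target)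
    (v : BaseModel n) :
    differential (E := Euc (n + 1)) φ (φ.symm z) (tangentParam φ.symm z v) = v := by
  have h1 := mfderiv_comp z (h.mdifferentiableAt (φ.map_target hz)) (h.mdifferentiableAt_symm hz)
  have h2 : (φ ∘ φ.symm) =ᶠ[𝓝 z] id := by
    filter_upwards [φ.open_target.mem_nhds hz] with q hq using φ.right_inv hq
  rw [h2.mfderiv_eq, mfderiv_id] at h1
  exact (DFunLike.congr_fun h1 v).symm

theorem differential_proj (h : IsAdapted π φ) {p : M} (hp : p ∈ φ.source)
    (v : TangentSpace (𝓡 (n + 1)) p) :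
    differential π p v = (differential φ p v).1 := by
  have h2 : π =ᶠ[𝓝 p] (Prod.fst ∘ φ) := by
    filter_upwards [φ.open_source.mem_nhds hp] with q hq using (h.fst_eq q hq).symm
  have h3 : MDifferentiableAt 𝓘(ℝ, BaseModel n) 𝓘(ℝ, ℝ) (Prod.fst : BaseModel n → ℝ) (φ p) :=
    differentiableAt_fst.mdifferentiableAt
  have h4 := mfderiv_comp p h3 (h.mdifferentiableAt hp)
  rw [← h2.mfderiv_eq, mfderiv_eq_fderiv, fderiv_fst] at h4
  exact DFunLike.congr_fun h4 v

end IsAdapted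

namespace IsAdapted
variable {φ : OpenPartialHomeomorph M (BaseModel n)}

/-- The jet with induced coordinates `((t, x), y)`. -/
def jetOf (h : IsAdapted π φ) (w : JetModel n) (hw : w.1 ∈ φ.target) : J1 n π :=
  ⟨⟨φ.symm w.1, tangentParam φ.symm w.1 (1, w.2)⟩, by
    rw [h.differential_proj (φ.map_target hw), h.differential_tangentParam hw]⟩

/-- The coordinates `((t, x), y)` on `J¹π` induced by coordinates `(t, x)` on `M`. -/
def jetCoord (_h : IsAdapted π φ) (u : J1 n π) : JetModel n :=
  (φ u.pt, (differential φ u.pt u.vel).2)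

theorem jetOf_jetCoord (h : IsAdapted π φ) (u : J1 n π) (hu : u.pt ∈ φ.source) :
    h.jetOf (h.jetCoord u) (φ.map_source hu) = u := by
  obtain ⟨⟨p, v⟩, hv⟩ := u
  have hu' : p ∈ φ.source := hu
  have hv' : differential π p v = 1 := hv
  apply Subtype.ext
  have key : ∀ q, q = p → ∀ w : TangentSpace (𝓡 (n + 1)) q, HEq w v →
      (⟨q, w⟩ : TangentBundle (𝓡 (n + 1)) M) = ⟨p, v⟩ := by
    rintro q rfl w hw
    rw [eq_of_heq hw]
  have e : ((1 : ℝ), (differential φ p v).2) = differential φ p v := by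
    rw [← hv', h.differential_proj hu']
  refine key (φ.symm (φ p)) (φ.left_inv hu') _ (heq_of_eq ?_)
  change tangentParam φ.symm (φ p) ((1 : ℝ), (differential φ p v).2) = v
  rw [e]
  exact h.tangentParam_differential hu' v

theorem jetCoord_jetOf (h : IsAdapted π φ) (w : JetModel n) (hw : w.1 ∈ φ.target) :
    h.jetCoord (h.jetOf w hw) = w := by
  refine Prod.ext (φ.right_inv hw) ?_
  change (differential φ (φ.symm w.1) (tangentParam φ.symm w.1 (1, w.2))).2 = w.2
  rw [h.differential_tangentParam hw]

end IsAdapted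

theorem contDiffOn_transition {φ φ' : OpenPartialHomeomorph M (BaseModel n)}
    (h : IsAdapted π φ) (h' : IsAdapted π φ') :
    ContDiffOn ℝ ∞ (φ' ∘ φ.symm) (φ.symm.trans φ').source := by
  rw [← contMDiffOn_iff_contDiffOn]
  refine h'.contMDiffOn.comp (h.contMDiffOn_symm.mono ?_) ?_
  · intro z hz
    exact hz.1
  · intro z hz
    exact hz.2

variable [IsManifold (𝓡 (n + 1)) ∞ M]

/-- The topology of `J¹π` as a subspace of the tangent bundle. -/
instance : TopologicalSpace (J1 n π) := instTopologicalSpaceSubtype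

namespace IsAdapted
variable {φ : OpenPartialHomeomorph M (BaseModel n)}

open Classical in
/-- The induced coordinates as a chart of `J¹π`; `u₀` is a junk value. -/
def jetChart (h : IsAdapted π φ) (u₀ : J1 n π) : OpenPartialHomeomorph (J1 n π) (JetModel n) where
  toFun := h.jetCoord
  invFun w := if hw : w.1 ∈ φ.target then h.jetOf w hw else u₀
  source := {u | u.pt ∈ φ.source}
  target := {w | w.1 ∈ φ.target}
  map_source' _ hu := φ.map_source hu
  map_target' w (hw : w.1 ∈ φ.target) := by
    rw [dif_pos hw]
    exact φ.map_target hw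
  left_inv' u hu := (dif_pos (φ.map_source hu)).trans (h.jetOf_jetCoord u hu)
  right_inv' w hw := (congrArg h.jetCoord (dif_pos hw)).trans (h.jetCoord_jetOf w hw)
  open_source := φ.open_source.preimage
    ((FiberBundle.continuous_proj (Euc (n + 1)) (TangentSpace (𝓡 (n + 1)))).comp
      continuous_subtype_val)
  open_target := φ.open_target.preimage continuous_fst
  continuousOn_toFun := by
    have h1 := h.contMDiffOn.continuousOn_tangentMapWithin (by simp)
      φ.open_source.uniqueMDiffOn
    have h2 := (tangentBundleModelSpaceHomeomorph 𝓘(ℝ, BaseModel n)).continuous.comp_continuousOn h1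
    have h3 := h2.comp (f := fun u : J1 n π => u.1) (s := {u : J1 n π | u.pt ∈ φ.source})
      continuous_subtype_val.continuousOn (fun u hu => hu)
    have h4 : ContinuousOn (fun w : BaseModel n × BaseModel n => (w.1, w.2.2)) univ := by fun_prop
    refine (h4.comp h3 (fun _ _ => mem_univ _)).congr ?_
    intro u hu
    have hu' : u.1.proj ∈ φ.source := hu
    have h5 : mfderivWithin (𝓡 (n + 1)) 𝓘(ℝ, BaseModel n) φ φ.source u.1.proj =
        mfderiv (𝓡 (n + 1)) 𝓘(ℝ, BaseModel n) φ u.1.proj :=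
      mfderivWithin_of_isOpen φ.open_source hu'
    change (φ u.1.proj, (differential φ u.1.proj u.1.snd).2) = (φ u.1.proj,
      (show BaseModel n from mfderivWithin (𝓡 (n + 1)) 𝓘(ℝ, BaseModel n) φ φ.source u.1.proj
        u.1.snd).2)
    rw [h5]
    rfl
  continuousOn_invFun := by
    have h1 := h.contMDiffOn_symm.continuousOn_tangentMapWithin (by simp)
      φ.open_target.uniqueMDiffOn
    have h2 : Continuous fun w : JetModel n =>
        (tangentBundleModelSpaceHomeomorph 𝓘(ℝ, BaseModel n)).symm (w.1, ((1 : ℝ), w.2)) :=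
      (tangentBundleModelSpaceHomeomorph 𝓘(ℝ, BaseModel n)).symm.continuous.comp (by fun_prop)
    have h3 := h1.comp (s := {w : JetModel n | w.1 ∈ φ.target}) h2.continuousOn (fun w hw => hw)
    refine Topology.IsInducing.subtypeVal.continuousOn_iff.2 (h3.congr ?_)
    intro w hw
    have hw' : w.1 ∈ φ.target := hw
    have e : (if hw : w.1 ∈ φ.target then h.jetOf w hw else u₀) = h.jetOf w hw' := dif_pos hw'
    have h5 : mfderivWithin 𝓘(ℝ, BaseModel n) (𝓡 (n + 1)) φ.symm φ.target w.1 =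
        mfderiv 𝓘(ℝ, BaseModel n) (𝓡 (n + 1)) φ.symm w.1 :=
      mfderivWithin_of_isOpen φ.open_target hw'
    refine (congrArg Subtype.val e).trans ?_
    change (⟨φ.symm w.1, mfderiv 𝓘(ℝ, BaseModel n) (𝓡 (n + 1)) φ.symm w.1 ((1 : ℝ), w.2)⟩ :
      TangentBundle (𝓡 (n + 1)) M) = ⟨φ.symm w.1,
        mfderivWithin 𝓘(ℝ, BaseModel n) (𝓡 (n + 1)) φ.symm φ.target w.1 ((1 : ℝ), w.2)⟩
    rw [h5]

end IsAdapted

theorem contDiffOn_jetTransition {φ φ' : OpenPartialHomeomorph M (BaseModel n)}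
    (h : IsAdapted π φ) (h' : IsAdapted π φ') (u u' : J1 n π) :
    ContDiffOn ℝ ∞ ((h.jetChart u).symm.trans (h'.jetChart u'))
      ((h.jetChart u).symm.trans (h'.jetChart u')).source := by
  have hT := contDiffOn_transition h h'
  have hO := (φ.symm.trans φ').open_source
  have hmaps : MapsTo Prod.fst ((h.jetChart u).symm.trans (h'.jetChart u')).source
      (φ.symm.trans φ').source := by
    rintro w ⟨hw, hw'⟩
    have hw1 : w.1 ∈ φ.target := hw
    refine ⟨hw, ?_⟩
    have e : (h.jetChart u).symm w = h.jetOf w hw := dif_pos hw1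
    change ((h.jetChart u).symm w).pt ∈ φ'.source at hw'
    rw [e] at hw'
    exact hw'
  have h1 := (hT.fderiv_of_isOpen (m := ∞) hO (by simp)).comp contDiff_fst.contDiffOn hmaps
  have h2 := hT.comp contDiff_fst.contDiffOn hmaps
  have h3 : ContDiffOn ℝ ∞ (fun w : JetModel n => ((1 : ℝ), w.2))
    ((h.jetChart u).symm.trans (h'.jetChart u')).source := by fun_prop
  refine (h2.prodMk (contDiff_snd.comp_contDiffOn (h1.clm_apply h3))).congr ?_
  intro w hw
  have hw0 := hmaps hw
  have hw1 : w.1 ∈ φ.target := hw.1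
  have e : (h.jetChart u).symm w = h.jetOf w hw.1 := dif_pos hw1
  change h'.jetCoord ((h.jetChart u).symm w) = _
  rw [e]
  have h4 := mfderiv_comp w.1 (h'.mdifferentiableAt hw0.2) (h.mdifferentiableAt_symm hw1)
  rw [mfderiv_eq_fderiv] at h4
  refine Prod.ext rfl ?_
  change (differential φ' (φ.symm w.1) (tangentParam φ.symm w.1 (1, w.2))).2 =
    (fderiv ℝ (φ' ∘ φ.symm) w.1 (1, w.2)).2
  exact congrArg Prod.snd (DFunLike.congr_fun h4 ((1 : ℝ), w.2)).symm

variable [IsFibred n π]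

/-- A choice of adapted coordinates around each point. -/
def adaptedChartAt (π : M → ℝ) [IsFibred n π] (p : M) : OpenPartialHomeomorph M (BaseModel n) :=
  (exists_isAdapted π p).choose

theorem isAdapted_adaptedChartAt (p : M) : IsAdapted π (adaptedChartAt (n := n) π p) :=
  (exists_isAdapted π p).choose_spec.1

/-- The manifold structure of `J¹π`, by the charts induced from all adapted charts of `M`. -/
instance : ChartedSpace (JetModel n) (J1 n π) where
  atlas := {e | ∃ (φ : OpenPartialHomeomorph M (BaseModel n)) (h : IsAdapted π φ) (u : J1 n π),
    e = h.jetChart u}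
  chartAt u := (isAdapted_adaptedChartAt u.pt).jetChart u
  mem_chart_source u := (exists_isAdapted π u.pt).choose_spec.2
  chart_mem_atlas u := ⟨_, _, u, rfl⟩

instance : IsManifold 𝓘(ℝ, JetModel n) ∞ (J1 n π) := by
  refine isManifold_of_contDiffOn _ _ _ ?_
  rintro _ _ ⟨φ, h, u, rfl⟩ ⟨φ', h', u', rfl⟩
  simpa using contDiffOn_jetTransition h h' u u'

end

section Forms

variable {E : Type*} [NormedAddCommGroup E] [NormedSpace ℝ E]
  {N : Type*} [TopologicalSpace N] [ChartedSpace E N]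

/-- Vector fields, not necessarily smooth, on a manifold `N` modelled on `E`. -/
abbrev VectorField (E : Type*) [NormedAddCommGroup E] [NormedSpace ℝ E]
    (N : Type*) [TopologicalSpace N] [ChartedSpace E N] : Type _ :=
  (u : N) → TangentSpace 𝓘(ℝ, E) u

/-- 1-forms, not necessarily smooth. -/
abbrev OneForm (E : Type*) [NormedAddCommGroup E] [NormedSpace ℝ E]
    (N : Type*) [TopologicalSpace N] [ChartedSpace E N] : Type _ :=
  (u : N) → TangentSpace 𝓘(ℝ, E) u →L[ℝ] ℝ

/-- Fields of bilinear forms, the type in which 2-forms live. -/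
abbrev TwoForm (E : Type*) [NormedAddCommGroup E] [NormedSpace ℝ E]
    (N : Type*) [TopologicalSpace N] [ChartedSpace E N] : Type _ :=
  (u : N) → TangentSpace 𝓘(ℝ, E) u →L[ℝ] TangentSpace 𝓘(ℝ, E) u →L[ℝ] ℝ

/-- The 1-form `θ` is smooth on `U`, as a section of the cotangent bundle. -/
def SmoothOneFormOn [IsManifold 𝓘(ℝ, E) ∞ N] (θ : OneForm E N) (U : Set N) : Prop :=
  ContMDiffOn 𝓘(ℝ, E) (𝓘(ℝ, E).prod 𝓘(ℝ, E →L[ℝ] ℝ)) ∞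
    (fun u => Bundle.TotalSpace.mk' (E →L[ℝ] ℝ)
      (E := fun v : N => TangentSpace 𝓘(ℝ, E) v →L[ℝ] ℝ) u (θ u)) U

/-- The expression of `θ` in the preferred chart at `u`: its pull-back by the inverse of the chart. -/
def inChart (θ : OneForm E N) (u : N) (z : E) : E →L[ℝ] ℝ :=
  (θ ((chartAt E u).symm z)).comp (tangentParam (chartAt E u).symm z)

/-- The exterior derivative of a 1-form, computed at `u` in the preferred chart at `u`, through which
the tangent space at `u` is identified with `E`: `dθ(v, w) = (D_v θ)(w) - (D_w θ)(v)`. -/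
def extDeriv₁ (θ : OneForm E N) : TwoForm E N := fun u =>
  let A : E →L[ℝ] E →L[ℝ] ℝ := fderiv ℝ (inChart θ u) (chartAt E u u)
  A - A.flip

/-- `(α ∧ β)(v, w) = α(v) β(w) - β(v) α(w)`. -/
def wedge (α β : OneForm E N) : TwoForm E N := fun u =>
  (α u).smulRight (β u) - (β u).smulRight (α u)

/-- The inner product `i_S β = β(S, ·)`. -/
def contract (S : VectorField E N) (β : TwoForm E N) : OneForm E N := fun u => β u (S u)

/-- The rank at `u` of a 2-form, i.e. of the linear map `v ↦ β(v, ·)`. -/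
def rankAt (β : TwoForm E N) (u : N) : ℕ :=
  Module.finrank ℝ (LinearMap.range (β u).toLinearMap)

/-- The Lie derivative of a 1-form, `L_S θ = d(i_S θ) + i_S dθ`. -/
def lieDerivative (S : VectorField E N) (θ : OneForm E N) : OneForm E N := fun u =>
  differential (fun v => θ v (S v)) u + contract S (extDeriv₁ θ) u

end Forms

section Jet
variable {n : ℕ} {M : Type*} [TopologicalSpace M] [ChartedSpace (Euc (n + 1)) M]
  [IsManifold (𝓡 (n + 1)) ∞ M] 

variable (π : M → ℝ) [IsFibred n π]

/-- The 1-form `dt` on `J¹π`. -/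
def dt : OneForm (JetModel n) (J1 n π) := differential fun u => π u.pt

variable {π}

/-- `ξ` is vertical: it lies in the kernel of the differential of `π₁₀`. -/
def IsVertical {u : J1 n π} (ξ : TangentSpace 𝓘(ℝ, JetModel n) u) : Prop :=
  mfderiv 𝓘(ℝ, JetModel n) (𝓡 (n + 1)) (J1.pt : J1 n π → M) u ξ = 0

/-- The endomorphism `∂/∂yⁱ ⊗ (dxⁱ - yⁱ dt)` of the model space, at a point with fibre
coordinates `y`. -/
def modelJ (y : Euc n) : JetModel n →L[ℝ] JetModel n :=
  (ContinuousLinearMap.inr ℝ (BaseModel n) (Euc n)).comp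
    ((ContinuousLinearMap.snd ℝ ℝ (Euc n) - (ContinuousLinearMap.fst ℝ ℝ (Euc n)).smulRight y).comp
      (ContinuousLinearMap.fst ℝ (BaseModel n) (Euc n)))

theorem modelJ_apply (y : Euc n) (t : ℝ) (x η : Euc n) :
   modelJ y ((t, x), η) = (0, x - t • y) := rfl

/-- The vertical endomorphism `J = ∂/∂yⁱ ⊗ (dxⁱ - yⁱ dt)`. The tangent space at `u` is identified
with the model space through the preferred chart at `u`; by
`differential_verticalEndomorphism`, `J` has the same expression in all induced coordinates. -/
def verticalEndomorphism (u : J1 n π) :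
    TangentSpace 𝓘(ℝ, JetModel n) u →L[ℝ] TangentSpace 𝓘(ℝ, JetModel n) u :=
  modelJ (chartAt (JetModel n) u u).2

theorem jetChart_contMDiffOn {φ : OpenPartialHomeomorph M (BaseModel n)} (h : IsAdapted π φ) (u₀ : J1 n π) :
    ContMDiffOn 𝓘(ℝ, JetModel n) 𝓘(ℝ, JetModel n) ∞ (h.jetChart u₀) (h.jetChart u₀).source := 
  contMDiffOn_of_mem_maximalAtlas (IsManifold.subset_maximalAtlas ⟨φ, h, u₀, rfl⟩)

theorem contMDiff_pt : ContMDiff 𝓘(ℝ, JetModel n) (𝓡 (n + 1)) ∞ (J1.pt : J1 n π → M) := by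
  intro u
  have h := isAdapted_adaptedChartAt (n := n) (π := π) u.pt
  have hu : u ∈ (h.jetChart u).source := mem_chart_source _ u
  have h1 := jetChart_contMDiffOn h u
  have h2 : ContMDiff 𝓘(ℝ, JetModel n) 𝓘(ℝ, BaseModel n) ∞ (Prod.fst : JetModel n → BaseModel n) :=
    contDiff_fst.contMDiff
  have h3 := h.contMDiffOn_symm.comp (h2.comp_contMDiffOn h1) (fun u hu => (h.jetChart u).map_source hu)
  refine (h3.contMDiffAt ((h.jetChart u).open_source.mem_nhds hu)).congr_of_eventuallyEq ?_
  filter_upwards [(h.jetChart u).open_source.mem_nhds hu] with v hv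
  exact ((adaptedChartAt (n := n) π u.pt).left_inv hv).symm

/-- `J = ∂/∂yⁱ ⊗ (dxⁱ - yⁱ dt)` in every system of induced coordinates. -/
theorem differential_verticalEndomorphism {φ : OpenPartialHomeomorph M (BaseModel n)} (h : IsAdapted π φ) (u₀ u : J1 n π)
    (hu : u.pt ∈ φ.source) (ξ : TangentSpace 𝓘(ℝ, JetModel n) u) :
    differential (h.jetChart u₀) u (verticalEndomorphism u ξ) = modelJ (h.jetChart u₀ u).2 (differential (h.jetChart u₀) u ξ) := by
  have h0 := isAdapted_adaptedChartAt (n := n) (π := π) u.pt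
  set φ₀ := adaptedChartAt (n := n) π u.pt
  set c := h0.jetChart u with hc
  have hcc : chartAt (JetModel n) u = c := rfl
  have hu0 : u ∈ c.source := mem_chart_source _ u
  have huφ₀ : u.pt ∈ φ₀.source := hu0
  have hz : φ₀ u.pt ∈ (φ₀.symm.trans φ).source := ⟨φ₀.map_source huφ₀, by
    change φ₀.symm (φ₀ u.pt) ∈ φ.source
    rw [φ₀.left_inv huφ₀]; exact hu⟩
  have hO := (φ₀.symm.trans φ).open_source.mem_nhds hz
  have hT := (contDiffOn_transition h0 h).contDiffAt hO
  have hTfst : (fun z => (φ (φ₀.symm z)).1) =ᶠ[𝓝 (φ₀ u.pt)] Prod.fst := by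
    filter_upwards [hO] with z hz
    have hz1 : z ∈ φ₀.target := hz.1
    exact (h.fst_eq _ hz.2).trans
      ((h0.fst_eq _ (φ₀.map_target hz1)).symm.trans (congrArg Prod.fst (φ₀.right_inv hz1)))
  set T := φ ∘ φ₀.symm with hTdef
  set y := (c u).2 with hy
  have hz1 : (c u).1 = φ₀ u.pt := rfl
  let F : JetModel n → JetModel n := fun w => (T w.1, (fderiv ℝ T w.1 (1, w.2)).2)
  have hFc : ∀ᶠ w in 𝓝 (c u), h.jetChart u₀ (c.symm w) = F w := by
    have : c.target ∩ {w : JetModel n | w.1 ∈ (φ₀.symm.trans φ).source} ∈ 𝓝 (c u) :=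
      Filter.inter_mem (c.open_target.mem_nhds (c.map_source hu0))
        (continuous_fst.continuousAt.preimage_mem_nhds hO)
    filter_upwards [this] with w hw
    have hw0 := hw.2
    have hw1 : w.1 ∈ φ₀.target := hw.1
    have e : c.symm w = h0.jetOf w hw1 := dif_pos hw1
    change h.jetCoord (c.symm w) = _
    rw [e]
    have h4 := mfderiv_comp w.1 (h.mdifferentiableAt hw0.2) (h0.mdifferentiableAt_symm hw1)
    rw [mfderiv_eq_fderiv] at h4
    refine Prod.ext rfl ?_
    change (differential φ (φ₀.symm w.1) (tangentParam φ₀.symm w.1 (1, w.2))).2 =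
      (fderiv ℝ (φ ∘ φ₀.symm) w.1 (1, w.2)).2
    exact congrArg Prod.snd (DFunLike.congr_fun h4 ((1 : ℝ), w.2)).symm
  have hd : (differential (h.jetChart u₀) u : JetModel n →L[ℝ] JetModel n) = fderiv ℝ F (c u) := by
    have hm : MDifferentiableAt 𝓘(ℝ, JetModel n) 𝓘(ℝ, JetModel n) (h.jetChart u₀) u :=
      ((jetChart_contMDiffOn h u₀).contMDiffAt
        ((h.jetChart u₀).open_source.mem_nhds hu)).mdifferentiableAt (by simp)
    rw [← Filter.EventuallyEq.fderiv_eq hFc]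
    have e5 : differential (h.jetChart u₀) u = fderivWithin ℝ (writtenInExtChartAt 𝓘(ℝ, JetModel n)
      𝓘(ℝ, JetModel n) u (h.jetChart u₀)) (range 𝓘(ℝ, JetModel n)) (extChartAt 𝓘(ℝ, JetModel n) u u)
      := if_pos hm
    refine e5.trans ?_
    rw [ModelWithCorners.range_eq_univ, fderivWithin_univ]
    rfl
  have hA : HasFDerivAt T (fderiv ℝ T (c u).1) (c u).1 :=
    (hT.differentiableAt (by simp)).hasFDerivAt
  set A := fderiv ℝ T (c u).1 with hAdef
  have hAfst : ∀ ζ, (A ζ).1 = ζ.1 := by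
    intro ζ
    have e1 : HasFDerivAt (fun z => (T z).1) ((ContinuousLinearMap.fst ℝ ℝ (Euc n)).comp A) (c u).1 :=
      hA.fst
    have e2 : HasFDerivAt (fun z => (T z).1) (ContinuousLinearMap.fst ℝ ℝ (Euc n)) (c u).1 :=
      hasFDerivAt_fst.congr_of_eventuallyEq hTfst
    exact DFunLike.congr_fun (e1.unique e2) ζ
  obtain ⟨B, hB⟩ : ∃ B, HasFDerivAt (fderiv ℝ T) B (c u).1 :=
    ⟨_, ((hT.fderiv_right (m := 1) (by norm_cast)).differentiableAt (by simp)).hasFDerivAt⟩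
  obtain ⟨D, hF, hD⟩ : ∃ D : JetModel n →L[ℝ] JetModel n, HasFDerivAt F D (c u) ∧
      ∀ ζ η, D (ζ, η) = (A ζ, (A (0, η) + B ζ (1, y)).2) :=
    ⟨_, (hA.comp (c u) hasFDerivAt_fst).prodMk
      (((hB.comp (c u) hasFDerivAt_fst).clm_apply
        ((hasFDerivAt_const (1 : ℝ) (c u)).prodMk hasFDerivAt_snd)).snd), fun _ _ => rfl⟩
  change (differential (h.jetChart u₀) u : JetModel n →L[ℝ] JetModel n) (modelJ y ξ) = modelJ _
    ((differential (h.jetChart u₀) u : JetModel n →L[ℝ] JetModel n) ξ)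
  have hy' : (h.jetChart u₀ u).2 = (A (1, y)).2 := by
    have := hFc.self_of_nhds
    rw [c.left_inv hu0] at this
    rw [this]
  rw [hd, hF.fderiv, hy']
  suffices hfin : ∀ (t : ℝ) (x η : Euc n),
      D (modelJ y ((t, x), η)) = modelJ (A (1, y)).2 (D ((t, x), η)) from hfin _ _ _
  intro t x η
  rw [modelJ_apply, hD, hD]
  have e3 : ((0 : ℝ), x - t • y) = (t, x) - t • ((1 : ℝ), y) := by simp
  have e4 : (A ((0 : ℝ), x - t • y)).2 = (A (t, x)).2 - t • (A (1, y)).2 := by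
    rw [e3, map_sub, map_smul]; rfl
  have e5 : ∀ w : JetModel n, modelJ (A (1, y)).2 w = (0, w.1.2 - w.1.1 • (A (1, y)).2) := fun w => rfl
  rw [e5, hAfst]
  simp [e4]

/-- A semispray: a smooth vector field on the whole of `J¹π` with `J(S) = 0` and `dt(S) = 1`. -/
structure IsSemispray (S : VectorField (JetModel n) (J1 n π)) : Prop where
  smooth : ContMDiff 𝓘(ℝ, JetModel n) 𝓘(ℝ, JetModel n).tangent ∞
    fun u => (⟨u, S u⟩ : TangentBundle 𝓘(ℝ, JetModel n) (J1 n π))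
  verticalEndomorphism_eq_zero : ∀ u, verticalEndomorphism u (S u) = 0
  dt_eq_one : ∀ u, dt π u (S u) = 1

/-- `θ` is a (smooth) semi-basic 1-form on `U`: it vanishes on vertical vectors. -/
structure IsSemiBasicOn (θ : OneForm (JetModel n) (J1 n π)) (U : Set (J1 n π)) : Prop where
  smooth : SmoothOneFormOn θ U
  apply_vertical : ∀ u ∈ U, ∀ ξ : TangentSpace 𝓘(ℝ, JetModel n) u, IsVertical ξ → θ u ξ = 0

/-- `θ` is non-degenerate on `U`: the 2-form `dθ + i_S dθ ∧ dt` has rank `2n` at every point. -/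
def IsNondegenerateOn (S : VectorField (JetModel n) (J1 n π))
    (θ : OneForm (JetModel n) (J1 n π)) (U : Set (J1 n π)) : Prop :=
  ∀ u ∈ U, rankAt (extDeriv₁ θ + wedge (contract S (extDeriv₁ θ)) (dt π)) u = 2 * n

/-- The Poincaré-Cartan 1-form `θ_L = L dt + d_J L`, where `d_J L = i_J dL = dL ∘ J`. -/
def poincareCartan (L : J1 n π → ℝ) : OneForm (JetModel n) (J1 n π) := fun u =>
  L u • dt π u + (differential L u).comp (verticalEndomorphism u)

/-- `L` is a regular Lagrangian on `U`: it is smooth there and `dθ_L` has rank `2n` at every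
point. -/
structure IsRegularLagrangianOn (L : J1 n π → ℝ) (U : Set (J1 n π)) : Prop where
  smooth : ContMDiffOn 𝓘(ℝ, JetModel n) 𝓘(ℝ, ℝ) ∞ L U
  rank_eq : ∀ u ∈ U, rankAt (extDeriv₁ (poincareCartan L)) u = 2 * n

/-- `L_S θ_L = dL` on `U`. -/
def SatisfiesEulerLagrangeOn (S : VectorField (JetModel n) (J1 n π)) (L : J1 n π → ℝ)
    (U : Set (J1 n π)) : Prop :=
  ∀ u ∈ U, lieDerivative S (poincareCartan L) u = differential L u

/-- `S` is Lagrangian over `W`: around each point of `W` there is a locally defined regular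
Lagrangian `L` with `L_S θ_L = dL`. -/
def IsLagrangianOver (S : VectorField (JetModel n) (J1 n π)) (W : Set (J1 n π)) : Prop :=
  ∀ u ∈ W, ∃ U : Set (J1 n π), IsOpen U ∧ u ∈ U ∧ ∃ L : J1 n π → ℝ,
    IsRegularLagrangianOn L U ∧ SatisfiesEulerLagrangeOn S L U

/-- `S` is a Lagrangian vector field. -/
def IsLagrangianVectorField (S : VectorField (JetModel n) (J1 n π)) : Prop :=
  IsLagrangianOver S Set.univ

end Jet

end JetBundle

end

open JetBundle

/-!
In induced coordinates a semispray is `S = ∂/∂t + yⁱ ∂/∂xⁱ + fⁱ ∂/∂yⁱ`, and a semi-basic form is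
`θ = θ₀ dt + θᵢ (dxⁱ - yⁱ dt)` with `θ₀ = θ(S)`. The `dyⁱ` component of `L_S θ` is `θᵢ`; without
coordinates, `i_J L_S θ = θ - θ(S) dt`
(`IsSemiBasicOn.lieDerivative_verticalEndomorphism`).

Let `L_S θ` be closed. By the Poincaré lemma (`exists_differential_eq_of_extDeriv₁_eq_zero`) it is
locally `dL`. The identity above says `dL ∘ J = θ - θ(S) dt`, so that `θ_L = θ + g dt` with
`g = L - θ(S)`. By Cartan's formula `dg = dL - d(θ(S)) = i_S dθ`, and therefore
`dθ_L = dθ + i_S dθ ∧ dt`: the 2-form whose rank expresses non-degeneracy of `θ` is the one whose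
rank expresses regularity of `L`. Contracting with `S` and using `dt(S) = 1` gives `i_S dθ_L = 0`,
which together with `θ_L(S) = L` is the equation `L_S θ_L = dL`
(`isRegularLagrangianOn_of_differential_eq_lieDerivative`).

Conversely, if `L_S θ_L = dL`, then `i_S dθ_L = 0` because `θ_L(S) = L`. Hence the 2-form attached to
`θ = θ_L` is `dθ_L` itself, of rank `2n`, and `L_S θ_L = dL` is closed
(`SatisfiesEulerLagrangeOn.semiBasic_poincareCartan`).

Pointwise identities are computed in the preferred chart at the point, through which the tangent
space is identified with the model space. The Poincaré lemma needs a fixed chart instead; for this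
the exterior derivative is shown to be computable in every preferred chart
(`extDeriv₁_apply_of_mem_source`).
-/

noncomputable section

namespace JetBundle

open Set

/-! ### Forms and vector fields in charts -/

section Charts

variable {E : Type*} [NormedAddCommGroup E] [NormedSpace ℝ E]
  {N : Type*} [TopologicalSpace N] [ChartedSpace E N]
  {V : Type*} [NormedAddCommGroup V] [NormedSpace ℝ V]

/-- The component function of the vector field `S` in the preferred chart at `u`. -/
def vecInChart (S : VectorField E N) (u : N) (z : E) : E :=
  differential (chartAt E u) ((chartAt E u).symm z) (S ((chartAt E u).symm z))

theorem vecInChart_chart (S : VectorField E N) {u v : N} (hv : v ∈ (chartAt E u).source) :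
    vecInChart S u (chartAt E u v) = differential (chartAt E u) v (S v) := by
  unfold vecInChart
  rw [(chartAt E u).left_inv hv]

theorem contMDiffAt_comp_chart_iff [IsManifold 𝓘(ℝ, E) ∞ N] {f : N → V} {u v : N}
    (hv : v ∈ (chartAt E u).source) :
    ContMDiffAt 𝓘(ℝ, E) 𝓘(ℝ, V) ∞ f v ↔
      ContDiffAt ℝ ∞ (f ∘ (chartAt E u).symm) (chartAt E u v) := by
  have hz := (chartAt E u).map_source hv
  rw [← contMDiffAt_iff_contDiffAt]
  constructor
  · intro hf
    have h := contMDiffOn_chart_symm (I := 𝓘(ℝ, E)) (n := ∞) (x := u) |>.contMDiffAt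
      ((chartAt E u).open_target.mem_nhds hz)
    refine ContMDiffAt.comp _ ?_ h
    rwa [(chartAt E u).left_inv hv]
  · intro hf
    have h := contMDiffOn_chart (I := 𝓘(ℝ, E)) (n := ∞) (x := u) |>.contMDiffAt
      ((chartAt E u).open_source.mem_nhds hv)
    refine (hf.comp v h).congr_of_eventuallyEq ?_
    filter_upwards [(chartAt E u).open_source.mem_nhds hv] with w hw
    simp [(chartAt E u).left_inv hw]

section
variable [IsManifold 𝓘(ℝ, E) 1 N]

theorem tangentParam_differential_chart {u v : N} (hv : v ∈ (chartAt E u).source)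
    (ξ : TangentSpace 𝓘(ℝ, E) v) :
    tangentParam (E := E) (chartAt E u).symm (chartAt E u v)
      (differential (chartAt E u) v ξ) = ξ :=
  DFunLike.congr_fun ((mdifferentiable_chart (I := 𝓘(ℝ, E)) u).symm_comp_deriv hv) ξ

theorem differential_chart_tangentParam {u : N} {z : E} (hz : z ∈ (chartAt E u).target) (e : E) :
    differential (chartAt E u) ((chartAt E u).symm z)
      (tangentParam (E := E) (chartAt E u).symm z e) = e :=
  DFunLike.congr_fun ((mdifferentiable_chart (I := 𝓘(ℝ, E)) u).comp_symm_deriv hz) e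

theorem differential_eq_fderiv {f : N → V} {u v : N} (hv : v ∈ (chartAt E u).source)
    (hf : MDifferentiableAt 𝓘(ℝ, E) 𝓘(ℝ, V) f v) (ξ : TangentSpace 𝓘(ℝ, E) v) :
    differential f v ξ = fderiv ℝ (f ∘ (chartAt E u).symm) (chartAt E u v)
      (differential (chartAt E u) v ξ) := by
  have hz := (chartAt E u).map_source hv
  have h1 : MDifferentiableAt 𝓘(ℝ, E) 𝓘(ℝ, V) (f ∘ (chartAt E u).symm) (chartAt E u v) := by
    refine MDifferentiableAt.comp (I' := 𝓘(ℝ, E)) _ ?_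
      ((mdifferentiable_chart (I := 𝓘(ℝ, E)) u).mdifferentiableAt_symm hz)
    rwa [(chartAt E u).left_inv hv]
  have h2 := mfderiv_comp v h1 ((mdifferentiable_chart (I := 𝓘(ℝ, E)) u).mdifferentiableAt hv)
  have h3 : (f ∘ (chartAt E u).symm) ∘ chartAt E u =ᶠ[𝓝 v] f := by
    filter_upwards [(chartAt E u).open_source.mem_nhds hv] with w hw
    simp [(chartAt E u).left_inv hw]
  rw [h3.mfderiv_eq, mfderiv_eq_fderiv] at h2
  exact DFunLike.congr_fun h2 ξ

theorem inChart_differential {f : N → ℝ} {u : N} {z : E} (hz : z ∈ (chartAt E u).target)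
    (hf : MDifferentiableAt 𝓘(ℝ, E) 𝓘(ℝ, ℝ) f ((chartAt E u).symm z)) :
    inChart (differential f) u z = fderiv ℝ (f ∘ (chartAt E u).symm) z := by
  have h := mfderiv_comp z hf
    ((mdifferentiable_chart (I := 𝓘(ℝ, E)) u).mdifferentiableAt_symm hz)
  rw [mfderiv_eq_fderiv] at h
  exact h.symm

/-- The identification of the tangent space at `u` with `E` is the differential of the preferred
chart at `u`. -/
theorem differential_chart_self (u : N) (ξ : TangentSpace 𝓘(ℝ, E) u) :
    differential (chartAt E u) u ξ = ξ := by
  have h : differential (chartAt E u) u = fderiv ℝ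
      (chartAt E u ∘ (chartAt E u).symm) (chartAt E u u) := by
    refine (if_pos ((mdifferentiable_chart (I := 𝓘(ℝ, E)) u).mdifferentiableAt
      (mem_chart_source E u))).trans ?_
    rw [ModelWithCorners.range_eq_univ, fderivWithin_univ]
    rfl
  have h2 : chartAt E u ∘ (chartAt E u).symm =ᶠ[𝓝 (chartAt E u u)] id := by
    filter_upwards [(chartAt E u).open_target.mem_nhds (mem_chart_target E u)] with z hz
    exact (chartAt E u).right_inv hz
  rw [h, h2.fderiv_eq, fderiv_id]
  rfl

theorem oneForm_apply_eq_inChart (θ : OneForm E N) {u v : N} (hv : v ∈ (chartAt E u).source)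
    (ξ : TangentSpace 𝓘(ℝ, E) v) :
    θ v ξ = inChart θ u (chartAt E u v) (differential (chartAt E u) v ξ) := by
  -- The tangent spaces at `c⁻¹ (c v)` and at `v` agree only after rewriting the base point.
  have key : ∀ q, q = v → ∀ e : E, (θ q : E →L[ℝ] ℝ) e = (θ v : E →L[ℝ] ℝ) e := by
    rintro q rfl e
    rfl
  refine (Eq.trans (key _ ((chartAt E u).left_inv hv) _) ?_).symm
  exact congrArg (θ v) (tangentParam_differential_chart hv ξ)

theorem oneForm_vec_comp_symm (θ : OneForm E N) (S : VectorField E N) {u : N} {z : E}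
    (hz : z ∈ (chartAt E u).target) :
    θ ((chartAt E u).symm z) (S ((chartAt E u).symm z)) = inChart θ u z (vecInChart S u z) := by
  rw [oneForm_apply_eq_inChart θ ((chartAt E u).map_target hz), (chartAt E u).right_inv hz]
  rfl

/-- In overlapping charts `c, c'`, with `T = c ∘ c'⁻¹`, the components of a 1-form in `c'` are the
pull-back by `T` of its components in `c`. -/
theorem inChart_eq_comp (θ : OneForm E N) {u v : N} {z : E} (hz : z ∈ (chartAt E v).target)
    (hz' : (chartAt E v).symm z ∈ (chartAt E u).source) :
    inChart θ v z = (inChart θ u ((chartAt E u ∘ (chartAt E v).symm) z)).comp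
      (fderiv ℝ (chartAt E u ∘ (chartAt E v).symm) z) := by
  have h := mfderiv_comp z ((mdifferentiable_chart (I := 𝓘(ℝ, E)) u).mdifferentiableAt hz')
    ((mdifferentiable_chart (I := 𝓘(ℝ, E)) v).mdifferentiableAt_symm hz)
  rw [mfderiv_eq_fderiv] at h
  rw [h]
  ext e
  exact oneForm_apply_eq_inChart θ hz' (tangentParam (E := E) (chartAt E v).symm z e)

end

variable [IsManifold 𝓘(ℝ, E) ∞ N]

theorem contDiffAt_chart_comp_symm {u v w : N} (hu : w ∈ (chartAt E u).source)
    (hv : w ∈ (chartAt E v).source) :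
    ContDiffAt ℝ ∞ (chartAt E u ∘ (chartAt E v).symm) (chartAt E v w) :=
  (contMDiffAt_comp_chart_iff hv).1 (contMDiffOn_chart.contMDiffAt
    ((chartAt E u).open_source.mem_nhds hu))

/-- Smoothness of a 1-form may be checked on its components in the preferred chart. -/
theorem contMDiffAt_oneForm_iff (θ : OneForm E N) (u : N) :
    ContMDiffAt 𝓘(ℝ, E) (𝓘(ℝ, E).prod 𝓘(ℝ, E →L[ℝ] ℝ)) ∞
    (fun u => Bundle.TotalSpace.mk' (E →L[ℝ] ℝ)
      (E := fun v : N => TangentSpace 𝓘(ℝ, E) v →L[ℝ] ℝ) u (θ u)) u ↔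
    ContDiffAt ℝ ∞ (inChart θ u) (chartAt E u u) := by
  have h := contMDiffAt_hom_bundle (IM := 𝓘(ℝ, E)) (IB := 𝓘(ℝ, E)) (n := ∞)
    (E₁ := fun v : N => TangentSpace 𝓘(ℝ, E) v) (E₂ := Bundle.Trivial N ℝ) (F₁ := E) (F₂ := ℝ)
    (fun u => Bundle.TotalSpace.mk' (E →L[ℝ] ℝ)
      (E := fun v : N => TangentSpace 𝓘(ℝ, E) v →L[ℝ] ℝ) u (θ u)) (x₀ := u)
  refine h.trans ((and_iff_right contMDiffAt_id).trans ?_)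
  rw [contMDiffAt_comp_chart_iff (mem_chart_source E u)]
  suffices hz : ∀ z ∈ (chartAt E u).target, ContinuousLinearMap.inCoordinates E
      (fun v : N => TangentSpace 𝓘(ℝ, E) v) ℝ (Bundle.Trivial N ℝ) u ((chartAt E u).symm z) u
      ((chartAt E u).symm z) (θ ((chartAt E u).symm z)) = inChart θ u z by
    have hev : (fun v => ContinuousLinearMap.inCoordinates E (fun v : N => TangentSpace 𝓘(ℝ, E) v)
        ℝ (Bundle.Trivial N ℝ) u v u v (θ v)) ∘ (chartAt E u).symm =ᶠ[𝓝 (chartAt E u u)]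
        inChart θ u := by
      filter_upwards [(chartAt E u).open_target.mem_nhds (mem_chart_target E u)] with z hz'
      exact hz z hz'
    exact ⟨fun h => h.congr_of_eventuallyEq hev.symm, fun h => h.congr_of_eventuallyEq hev⟩
  intro z hz
  have h3 := TangentBundle.symmL_trivializationAt (I := 𝓘(ℝ, E)) (x₀ := u)
    ((chartAt E u).map_target hz)
  have h4 : mfderivWithin 𝓘(ℝ, E) 𝓘(ℝ, E) (extChartAt 𝓘(ℝ, E) u).symm (range 𝓘(ℝ, E))
      (extChartAt 𝓘(ℝ, E) u ((chartAt E u).symm z)) =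
      mfderiv 𝓘(ℝ, E) 𝓘(ℝ, E) (chartAt E u).symm z := by
    rw [ModelWithCorners.range_eq_univ, mfderivWithin_univ]
    simp only [mfld_simps]
    have key : ∀ z', z' = z → (mfderiv 𝓘(ℝ, E) 𝓘(ℝ, E) (chartAt E u).symm z' : E →L[ℝ] E) =
        mfderiv 𝓘(ℝ, E) 𝓘(ℝ, E) (chartAt E u).symm z := by
      rintro z' rfl
      rfl
    exact key _ ((chartAt E u).right_inv hz)
  rw [h4] at h3
  unfold ContinuousLinearMap.inCoordinates
  rw [h3]
  ext e
  simp
  rfl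

/-- The components of a smooth vector field in the preferred chart at `u` are smooth at `u`; they
agree near `u` with the second component of the trivialization of the tangent bundle. -/
theorem contDiffAt_vecInChart_self {S : VectorField E N} {u : N}
    (hS : ContMDiff 𝓘(ℝ, E) 𝓘(ℝ, E).tangent ∞
      fun u => (⟨u, S u⟩ : TangentBundle 𝓘(ℝ, E) N)) :
    ContDiffAt ℝ ∞ (vecInChart S u) (chartAt E u u) := by
  have h := ((Bundle.contMDiffAt_totalSpace (IB := 𝓘(ℝ, E))).1 (hS u)).2
  rw [contMDiffAt_comp_chart_iff (mem_chart_source E u)] at h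
  refine h.congr_of_eventuallyEq ?_
  filter_upwards [(chartAt E u).open_target.mem_nhds (mem_chart_target E u)] with z hz
  have hv := (chartAt E u).map_target hz
  have h3 := TangentBundle.continuousLinearMapAt_trivializationAt (I := 𝓘(ℝ, E)) (x₀ := u) hv
  have h4 := Bundle.Trivialization.coe_linearMapAt_of_mem (R := ℝ)
    (trivializationAt E (TangentSpace 𝓘(ℝ, E) : N → Type _) u) (b := (chartAt E u).symm z) hv
  have h5 := congrFun h4 (S ((chartAt E u).symm z))
  have h6 := DFunLike.congr_fun h3 (S ((chartAt E u).symm z))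
  exact h6.symm.trans h5

/-- The components of a smooth 1-form are smooth in every preferred chart. -/
theorem SmoothOneFormOn.contDiffAt_inChart {θ : OneForm E N} {U : Set N} (hθ : SmoothOneFormOn θ U)
    (hU : IsOpen U) {u v : N} (hv : v ∈ (chartAt E u).source) (hvU : v ∈ U) :
    ContDiffAt ℝ ∞ (inChart θ u) (chartAt E u v) := by
  have h1 : ContDiffAt ℝ ∞ (inChart θ v) (chartAt E v v) :=
    (contMDiffAt_oneForm_iff θ v).1 (hθ.contMDiffAt (hU.mem_nhds hvU))
  have hT := contDiffAt_chart_comp_symm (mem_chart_source E v) hv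
  have hT' : ContDiffAt ℝ ∞ (fderiv ℝ (chartAt E v ∘ (chartAt E u).symm)) (chartAt E u v) :=
    hT.fderiv_right (by simp)
  have h2 : ContDiffAt ℝ ∞ (inChart θ v ∘ (chartAt E v ∘ (chartAt E u).symm)) (chartAt E u v) := by
    refine ContDiffAt.comp _ ?_ hT
    simpa [(chartAt E u).left_inv hv] using h1
  refine (h2.clm_comp hT').congr_of_eventuallyEq ?_
  filter_upwards [(chartAt E u).symm.isOpen_inter_preimage (chartAt E v).open_source |>.mem_nhds
    ⟨(chartAt E u).map_source hv, by simp [(chartAt E u).left_inv hv]⟩] with z hz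
  exact inChart_eq_comp θ hz.1 hz.2

/-- The components of a smooth vector field in a preferred chart are smooth at every point of the
chart domain. -/
theorem contDiffAt_vecInChart {S : VectorField E N}
    (hS : ContMDiff 𝓘(ℝ, E) 𝓘(ℝ, E).tangent ∞
      fun u => (⟨u, S u⟩ : TangentBundle 𝓘(ℝ, E) N)) {u v : N} (hv : v ∈ (chartAt E u).source) :
    ContDiffAt ℝ ∞ (vecInChart S u) (chartAt E u v) := by
  have h1 : ContDiffAt ℝ ∞ (vecInChart S v) (chartAt E v v) := contDiffAt_vecInChart_self hS
  have hT := contDiffAt_chart_comp_symm (mem_chart_source E v) hv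
  have hT2 := contDiffAt_chart_comp_symm hv (mem_chart_source E v)
  have hT' : ContDiffAt ℝ ∞ (fderiv ℝ (chartAt E u ∘ (chartAt E v).symm)) (chartAt E v v) :=
    hT2.fderiv_right (by simp)
  have h2 := (hT'.clm_apply h1)
  have h3 : ContDiffAt ℝ ∞ ((fun z => fderiv ℝ (chartAt E u ∘ (chartAt E v).symm) z
      (vecInChart S v z)) ∘ (chartAt E v ∘ (chartAt E u).symm)) (chartAt E u v) := by
    refine ContDiffAt.comp _ ?_ hT
    simpa [(chartAt E u).left_inv hv] using h2
  refine h3.congr_of_eventuallyEq ?_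
  filter_upwards [(chartAt E u).symm.isOpen_inter_preimage (chartAt E v).open_source |>.mem_nhds
    ⟨(chartAt E u).map_source hv, by simp [(chartAt E u).left_inv hv]⟩] with z hz
  have hzv : (chartAt E u).symm z ∈ (chartAt E v).source := hz.2
  have hzu : (chartAt E u).symm z ∈ (chartAt E u).source := (chartAt E u).map_target hz.1
  simp only [Function.comp_apply]
  rw [vecInChart_chart S hzv, ← differential_eq_fderiv hzv
    ((mdifferentiable_chart (I := 𝓘(ℝ, E)) u).mdifferentiableAt hzu)]
  rfl

end Charts

/-! ### The exterior derivative of 1-forms -/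

section ExteriorDerivative

variable {E : Type*} [NormedAddCommGroup E] [NormedSpace ℝ E]
  {N : Type*} [TopologicalSpace N] [ChartedSpace E N]

theorem two_le_infty : (2 : WithTop ℕ∞) ≤ ∞ := by norm_cast

/-- `d` commutes with pull-back by `T`: the second derivative of `T` is symmetric, so it drops
out. -/
theorem fderiv_pullback_sub_flip {α : E → E →L[ℝ] ℝ} {T : E → E} {z : E}
    (hα : DifferentiableAt ℝ α (T z)) (hT : ContDiffAt ℝ ∞ T z) (a b : E) :
    fderiv ℝ (fun z => (α (T z)).comp (fderiv ℝ T z)) z a b -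
      fderiv ℝ (fun z => (α (T z)).comp (fderiv ℝ T z)) z b a =
    fderiv ℝ α (T z) (fderiv ℝ T z a) (fderiv ℝ T z b) -
      fderiv ℝ α (T z) (fderiv ℝ T z b) (fderiv ℝ T z a) := by
  have hsymm : IsSymmSndFDerivAt ℝ T z := hT.isSymmSndFDerivAt (by simpa using two_le_infty)
  have hT1 : DifferentiableAt ℝ T z := hT.differentiableAt (by simp)
  have hT2 : DifferentiableAt ℝ (fderiv ℝ T) z :=
    (hT.fderiv_right (m := ∞) (by simp)).differentiableAt (by simp)
  have h := ((hα.hasFDerivAt.comp z hT1.hasFDerivAt).clm_comp hT2.hasFDerivAt).fderiv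
  simp only [Function.comp_def] at h
  rw [h]
  simp [hsymm.eq a b]

theorem extDeriv₁_apply (θ : OneForm E N) (u : N) (ξ η : TangentSpace 𝓘(ℝ, E) u) :
    extDeriv₁ θ u ξ η = fderiv ℝ (inChart θ u) (chartAt E u u) ξ η -
      fderiv ℝ (inChart θ u) (chartAt E u u) η ξ := rfl

theorem extDeriv₁_congr {θ θ' : OneForm E N} {v : N} (h : ∀ᶠ w in 𝓝 v, θ w = θ' w) :
    extDeriv₁ θ v = extDeriv₁ θ' v := by
  have hc : ContinuousAt (chartAt E v).symm (chartAt E v v) :=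
    (chartAt E v).continuousAt_symm (mem_chart_target E v)
  have h1 : inChart θ v =ᶠ[𝓝 (chartAt E v v)] inChart θ' v := by
    have h2 : Filter.Tendsto (chartAt E v).symm (𝓝 (chartAt E v v)) (𝓝 v) := by
      simpa [ContinuousAt] using hc
    filter_upwards [h2.eventually h] with z hz
    unfold inChart
    rw [hz]
  unfold extDeriv₁
  rw [h1.fderiv_eq]

theorem extDeriv₁_apply_self (θ : OneForm E N) (u : N) (ξ : TangentSpace 𝓘(ℝ, E) u) :
    extDeriv₁ θ u ξ ξ = 0 := sub_self _

variable [IsManifold 𝓘(ℝ, E) ∞ N]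

/-- The exterior derivative may be computed in any of the preferred charts. -/
theorem extDeriv₁_apply_of_mem_source (θ : OneForm E N) {u v : N} (hv : v ∈ (chartAt E u).source)
    (hθ : DifferentiableAt ℝ (inChart θ u) (chartAt E u v)) (ξ η : TangentSpace 𝓘(ℝ, E) v) :
    extDeriv₁ θ v ξ η =
      fderiv ℝ (inChart θ u) (chartAt E u v) (differential (chartAt E u) v ξ)
        (differential (chartAt E u) v η) -
      fderiv ℝ (inChart θ u) (chartAt E u v) (differential (chartAt E u) v η)
        (differential (chartAt E u) v ξ) := by
  have hT := contDiffAt_chart_comp_symm hv (mem_chart_source E v)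
  have hTv : (chartAt E u ∘ (chartAt E v).symm) (chartAt E v v) = chartAt E u v := by simp
  have hd : ∀ ζ : TangentSpace 𝓘(ℝ, E) v, differential (chartAt E u) v ζ =
      fderiv ℝ (chartAt E u ∘ (chartAt E v).symm) (chartAt E v v) ζ := by
    intro ζ
    rw [differential_eq_fderiv (mem_chart_source E v)
      ((mdifferentiable_chart (I := 𝓘(ℝ, E)) u).mdifferentiableAt hv), differential_chart_self]
  have h1 : inChart θ v =ᶠ[𝓝 (chartAt E v v)] fun z =>
      (inChart θ u ((chartAt E u ∘ (chartAt E v).symm) z)).comp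
      (fderiv ℝ (chartAt E u ∘ (chartAt E v).symm) z) := by
    filter_upwards [(chartAt E v).symm.isOpen_inter_preimage (chartAt E u).open_source |>.mem_nhds
      ⟨mem_chart_target E v, by simpa using hv⟩] with z hz
    exact inChart_eq_comp θ hz.1 hz.2
  rw [extDeriv₁_apply, h1.fderiv_eq, hd, hd]
  have h2 := fderiv_pullback_sub_flip (α := inChart θ u) (T := chartAt E u ∘ (chartAt E v).symm)
    (z := chartAt E v v) (by rwa [hTv]) hT ξ η
  rw [hTv] at h2
  exact h2

theorem inChart_differential_eventuallyEq {f : N → ℝ} {u v : N} (hv : v ∈ (chartAt E u).source)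
    (hf : ContMDiffAt 𝓘(ℝ, E) 𝓘(ℝ, ℝ) ∞ f v) :
    inChart (differential f) u =ᶠ[𝓝 (chartAt E u v)] fderiv ℝ (f ∘ (chartAt E u).symm) := by
  have h1 : ∀ᶠ w in 𝓝 v, ContMDiffAt 𝓘(ℝ, E) 𝓘(ℝ, ℝ) 1 f w :=
    (contMDiffAt_iff_contMDiffAt_nhds (by simp)).1 (hf.of_le (by simp))
  have h2 : Filter.Tendsto (chartAt E u).symm (𝓝 (chartAt E u v)) (𝓝 v) := by
    have := (chartAt E u).continuousAt_symm ((chartAt E u).map_source hv)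
    simpa [ContinuousAt, (chartAt E u).left_inv hv] using this
  filter_upwards [h2.eventually h1,
    (chartAt E u).open_target.mem_nhds ((chartAt E u).map_source hv)] with z hz hz'
  exact inChart_differential hz' (hz.mdifferentiableAt (by simp))

theorem contDiffAt_inChart_differential {f : N → ℝ} {u v : N} (hv : v ∈ (chartAt E u).source)
    (hf : ContMDiffAt 𝓘(ℝ, E) 𝓘(ℝ, ℝ) ∞ f v) :
    ContDiffAt ℝ ∞ (inChart (differential f) u) (chartAt E u v) :=
  (((contMDiffAt_comp_chart_iff hv).1 hf).fderiv_right (by simp)).congr_of_eventuallyEq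
    (inChart_differential_eventuallyEq hv hf)

/-- `d² = 0` on functions. -/
theorem extDeriv₁_differential {f : N → ℝ} {v : N} (hf : ContMDiffAt 𝓘(ℝ, E) 𝓘(ℝ, ℝ) ∞ f v) :
    extDeriv₁ (differential f : OneForm E N) v = 0 := by
  have hsymm : IsSymmSndFDerivAt ℝ (f ∘ (chartAt E v).symm) (chartAt E v v) :=
    ((contMDiffAt_comp_chart_iff (mem_chart_source E v)).1 hf).isSymmSndFDerivAt
      (by simpa using two_le_infty)
  ext ξ η
  rw [extDeriv₁_apply, (inChart_differential_eventuallyEq (mem_chart_source E v) hf).fderiv_eq]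
  exact sub_eq_zero.2 (hsymm.eq ξ η)

/-- `d(θ + g dτ) = dθ + dg ∧ dτ`. -/
theorem extDeriv₁_add_smul_differential {θ : OneForm E N} {g τ : N → ℝ} {v : N}
    (hθ : DifferentiableAt ℝ (inChart θ v) (chartAt E v v))
    (hg : ContMDiffAt 𝓘(ℝ, E) 𝓘(ℝ, ℝ) ∞ g v) (hτ : ContMDiffAt 𝓘(ℝ, E) 𝓘(ℝ, ℝ) ∞ τ v) :
    extDeriv₁ (fun w => θ w + g w • differential τ w : OneForm E N) v =
      extDeriv₁ θ v + wedge (differential g) (differential τ) v := by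
  have hv := mem_chart_source E v
  have hg1 := ((contMDiffAt_comp_chart_iff hv).1 hg).differentiableAt (by simp)
  have hτ1 := (contDiffAt_inChart_differential hv hτ).differentiableAt (by simp)
  have h0 := congrFun (congrArg DFunLike.coe (extDeriv₁_differential hτ))
  have h1 : inChart (fun w => θ w + g w • differential τ w : OneForm E N) v =
      fun z => inChart θ v z + (g ∘ (chartAt E v).symm) z • inChart (differential τ) v z := by
    funext z
    ext e
    rfl
  have h2 := (hθ.hasFDerivAt.add (hg1.hasFDerivAt.smul hτ1.hasFDerivAt)).fderiv
  have hd : ∀ {f : N → ℝ}, ContMDiffAt 𝓘(ℝ, E) 𝓘(ℝ, ℝ) ∞ f v →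
      ∀ ζ : TangentSpace 𝓘(ℝ, E) v, differential f v ζ =
        fderiv ℝ (f ∘ (chartAt E v).symm) (chartAt E v v) ζ := by
    intro f hf ζ
    rw [differential_eq_fderiv hv (hf.mdifferentiableAt (by simp)), differential_chart_self]
  ext ξ η
  have h3 := DFunLike.congr_fun (h0 ξ) η
  rw [extDeriv₁_apply] at h3
  have h4 : ∀ a b, fderiv ℝ (fun z => inChart θ v z + (g ∘ (chartAt E v).symm) z •
      inChart (differential τ) v z) (chartAt E v v) a b =
      fderiv ℝ (inChart θ v) (chartAt E v v) a b +
      ((g ∘ (chartAt E v).symm) (chartAt E v v) * fderiv ℝ (inChart (differential τ) v)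
        (chartAt E v v) a b + fderiv ℝ (g ∘ (chartAt E v).symm) (chartAt E v v) a *
        inChart (differential τ) v (chartAt E v v) b) := by
    intro a b
    exact DFunLike.congr_fun (DFunLike.congr_fun h2 a) b
  rw [extDeriv₁_apply, h1]
  refine (congrArg₂ (· - ·) (h4 ξ η) (h4 η ξ)).trans ?_
  change _ = extDeriv₁ θ v ξ η + (differential g v ξ * differential τ v η -
    differential τ v ξ * differential g v η)
  rw [(inChart_differential_eventuallyEq hv hτ).eq_of_nhds, extDeriv₁_apply, hd hg, hd hg, hd hτ,
    hd hτ]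
  have h5 := sub_eq_zero.1 h3
  linear_combination (g ∘ (chartAt E v).symm) (chartAt E v v) * h5

theorem SmoothOneFormOn.contMDiffAt_apply {θ : OneForm E N} {S : VectorField E N} {U : Set N}
    (hθ : SmoothOneFormOn θ U) (hU : IsOpen U)
    (hS : ContMDiff 𝓘(ℝ, E) 𝓘(ℝ, E).tangent ∞
      fun u => (⟨u, S u⟩ : TangentBundle 𝓘(ℝ, E) N)) {v : N} (hv : v ∈ U) :
    ContMDiffAt 𝓘(ℝ, E) 𝓘(ℝ, ℝ) ∞ (fun w => θ w (S w)) v := by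
  rw [contMDiffAt_comp_chart_iff (mem_chart_source E v)]
  refine ((hθ.contDiffAt_inChart hU (mem_chart_source E v) hv).clm_apply
    (contDiffAt_vecInChart hS (mem_chart_source E v))).congr_of_eventuallyEq ?_
  filter_upwards [(chartAt E v).open_target.mem_nhds (mem_chart_target E v)] with z hz
  exact oneForm_vec_comp_symm θ S hz

/-- The Lie derivative `d(θ(S)) + i_S dθ` in components. -/
theorem inChart_lieDerivative {θ : OneForm E N} {S : VectorField E N} {U : Set N}
    (hθ : SmoothOneFormOn θ U) (hU : IsOpen U)
    (hS : ContMDiff 𝓘(ℝ, E) 𝓘(ℝ, E).tangent ∞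
      fun u => (⟨u, S u⟩ : TangentBundle 𝓘(ℝ, E) N)) {u : N} {z : E}
    (hz : z ∈ (chartAt E u).target) (hzU : (chartAt E u).symm z ∈ U) :
    inChart (lieDerivative S θ) u z =
      fderiv ℝ (fun z => inChart θ u z (vecInChart S u z)) z +
      fderiv ℝ (inChart θ u) z (vecInChart S u z) -
      (fderiv ℝ (inChart θ u) z).flip (vecInChart S u z) := by
  have hv := (chartAt E u).map_target hz
  have hθ' := (hθ.contDiffAt_inChart hU hv hzU).differentiableAt (by simp)
  have hf := (hθ.contMDiffAt_apply hU hS hzU).mdifferentiableAt (by simp)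
  have h1 : (fun v => θ v (S v)) ∘ (chartAt E u).symm =ᶠ[𝓝 z]
      fun z => inChart θ u z (vecInChart S u z) := by
    filter_upwards [(chartAt E u).open_target.mem_nhds hz] with z hz
    exact oneForm_vec_comp_symm θ S hz
  have h2 := inChart_differential hz hf
  rw [h1.fderiv_eq] at h2
  rw [← h2]
  ext e
  have h3 := extDeriv₁_apply_of_mem_source θ hv hθ' (S ((chartAt E u).symm z))
    (tangentParam (E := E) (chartAt E u).symm z e)
  rw [differential_chart_tangentParam hz, ← vecInChart_chart S hv, (chartAt E u).right_inv hz] at h3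
  have h4 : ∀ a b c : ℝ, a + (b - c) = a + b - c := fun a b c => (add_sub_assoc a b c).symm
  refine Eq.trans ?_ (h4 _ _ _)
  exact congrArg (inChart (differential fun v => θ v (S v)) u z e + ·) h3

theorem SmoothOneFormOn.contDiffAt_inChart_lieDerivative {θ : OneForm E N} {S : VectorField E N}
    {U : Set N} (hθ : SmoothOneFormOn θ U) (hU : IsOpen U)
    (hS : ContMDiff 𝓘(ℝ, E) 𝓘(ℝ, E).tangent ∞
      fun u => (⟨u, S u⟩ : TangentBundle 𝓘(ℝ, E) N)) {u v : N} (hv : v ∈ (chartAt E u).source)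
    (hvU : v ∈ U) : ContDiffAt ℝ ∞ (inChart (lieDerivative S θ) u) (chartAt E u v) := by
  have h1 := hθ.contDiffAt_inChart hU hv hvU
  have h2 := contDiffAt_vecInChart hS hv
  have h3 := (h1.clm_apply h2).fderiv_right (m := ∞) (by simp)
  have h4 := h1.fderiv_right (m := ∞) (by simp)
  have hflip : ContDiff ℝ ∞ (fun A : E →L[ℝ] E →L[ℝ] ℝ => A.flip) := by
    exact LinearIsometryEquiv.contDiff (𝕜 := ℝ) (E := E →L[ℝ] E →L[ℝ] ℝ)
      (F := E →L[ℝ] E →L[ℝ] ℝ) (ContinuousLinearMap.flipₗᵢ ℝ E E ℝ)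
  have h5 : ContDiffAt ℝ ∞ (fun z => (fderiv ℝ (inChart θ u) z).flip (vecInChart S u z))
      (chartAt E u v) :=
    (ContDiffAt.comp _ (g := fun A : E →L[ℝ] E →L[ℝ] ℝ => A.flip)
      hflip.contDiffAt h4).clm_apply h2
  refine ((h3.add (h4.clm_apply h2)).sub h5).congr_of_eventuallyEq ?_
  filter_upwards [(chartAt E u).symm.isOpen_inter_preimage hU |>.mem_nhds
    ⟨(chartAt E u).map_source hv, by simpa [(chartAt E u).left_inv hv] using hvU⟩] with z hz
  exact inChart_lieDerivative hθ hU hS hz.1 hz.2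

/-- The Poincaré lemma: a closed 1-form is locally the differential of a function. It is read off
from the Poincaré lemma for a ball in a chart. -/
theorem exists_differential_eq_of_extDeriv₁_eq_zero {α : OneForm E N} {U : Set N} (hU : IsOpen U)
    {u : N} (hu : u ∈ U)
    (hα : ∀ v ∈ (chartAt E u).source ∩ U, ContDiffAt ℝ ∞ (inChart α u) (chartAt E u v))
    (hclosed : ∀ v ∈ U, extDeriv₁ α v = 0) :
    ∃ V ⊆ U, IsOpen V ∧ u ∈ V ∧ ∃ f : N → ℝ, ContMDiffOn 𝓘(ℝ, E) 𝓘(ℝ, ℝ) ∞ f V ∧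
      ∀ v ∈ V, differential f v = α v := by
  -- A ball in the chart, inside the image of `U`.
  obtain ⟨r, hr, hball⟩ := Metric.isOpen_iff.1 ((chartAt E u).symm.isOpen_inter_preimage hU)
    (chartAt E u u) ⟨mem_chart_target E u, by simpa using hu⟩
  set B := Metric.ball (chartAt E u u) r
  have hαB : ∀ z ∈ B, ContDiffAt ℝ ∞ (inChart α u) z := by
    intro z hz
    have := hα ((chartAt E u).symm z) ⟨(chartAt E u).map_target (hball hz).1, (hball hz).2⟩
    rwa [(chartAt E u).right_inv (hball hz).1] at this
  obtain ⟨F, hF⟩ := (convex_ball (chartAt E u u) r).exists_forall_hasFDerivAt_of_fderiv_symmetric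
    Metric.isOpen_ball
    (fun z hz => ((hαB z hz).differentiableAt (by simp)).differentiableWithinAt) (by
      intro z hz x y
      have hz' := (hball hz).1
      have h1 := extDeriv₁_apply_of_mem_source α ((chartAt E u).map_target hz')
        (by rw [(chartAt E u).right_inv hz']; exact (hαB z hz).differentiableAt (by simp))
        (tangentParam (E := E) (chartAt E u).symm z x)
        (tangentParam (E := E) (chartAt E u).symm z y)
      rw [hclosed _ (hball hz).2, differential_chart_tangentParam hz',
        differential_chart_tangentParam hz', (chartAt E u).right_inv hz'] at h1
      exact sub_eq_zero.1 h1.symm)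
  have hFB : ContDiffOn ℝ ∞ F B := by
    rw [contDiffOn_infty_iff_fderiv_of_isOpen Metric.isOpen_ball]
    refine ⟨fun z hz => (hF z hz).differentiableAt.differentiableWithinAt, fun z hz => ?_⟩
    refine ((hαB z hz).contDiffWithinAt).congr (fun w hw => (hF w hw).fderiv) (hF z hz).fderiv
  have hFc : ∀ z ∈ B, F =ᶠ[𝓝 z] (F ∘ chartAt E u) ∘ (chartAt E u).symm := by
    intro z hz
    filter_upwards [(chartAt E u).open_target.mem_nhds (hball hz).1] with w hw
    simp [(chartAt E u).right_inv hw]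
  have hsm : ∀ v ∈ (chartAt E u).source ∩ chartAt E u ⁻¹' B,
      ContMDiffAt 𝓘(ℝ, E) 𝓘(ℝ, ℝ) ∞ (F ∘ chartAt E u) v := by
    intro v hv
    rw [contMDiffAt_comp_chart_iff hv.1]
    exact (hFB.contDiffAt (Metric.isOpen_ball.mem_nhds hv.2)).congr_of_eventuallyEq
      (hFc _ hv.2).symm
  refine ⟨(chartAt E u).source ∩ chartAt E u ⁻¹' B, ?_,
    (chartAt E u).isOpen_inter_preimage Metric.isOpen_ball,
    ⟨mem_chart_source E u, Metric.mem_ball_self hr⟩, F ∘ chartAt E u,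
    fun v hv => (hsm v hv).contMDiffWithinAt, ?_⟩
  · intro v hv
    have := (hball hv.2).2
    simpa [(chartAt E u).left_inv hv.1] using this
  · intro v hv
    ext ξ
    rw [differential_eq_fderiv hv.1 ((hsm v hv).mdifferentiableAt (by simp)),
      ← (hFc _ hv.2).fderiv_eq, (hF _ hv.2).fderiv, ← oneForm_apply_eq_inChart α hv.1]

end ExteriorDerivative

/-! ### Semi-basic forms on the jet bundle -/

section JetForms

variable {n : ℕ} {M : Type*} [TopologicalSpace M] [ChartedSpace (Euc (n + 1)) M]
  [IsManifold (𝓡 (n + 1)) ∞ M] {π : M → ℝ} [IsFibred n π]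

theorem proj_pt_chart_symm {u : J1 n π} {z : JetModel n} (hz : z ∈ (chartAt (JetModel n) u).target) :
    π ((chartAt (JetModel n) u).symm z).pt = z.1.1 := by
  have hv := (chartAt (JetModel n) u).map_target hz
  have h1 := (isAdapted_adaptedChartAt (n := n) (π := π) u.pt).fst_eq _ hv
  have h2 := (chartAt (JetModel n) u).right_inv hz
  rw [← h1]
  exact congrArg (fun w : JetModel n => w.1.1) h2

theorem contMDiff_proj_pt : ContMDiff 𝓘(ℝ, JetModel n) 𝓘(ℝ, ℝ) ∞ fun u : J1 n π => π u.pt := by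
  intro u
  rw [contMDiffAt_comp_chart_iff (mem_chart_source (JetModel n) u)]
  have h : ContDiff ℝ ∞ fun z : JetModel n => z.1.1 := by fun_prop
  refine h.contDiffAt.congr_of_eventuallyEq ?_
  filter_upwards [(chartAt (JetModel n) u).open_target.mem_nhds (mem_chart_target _ u)] with z hz
  exact proj_pt_chart_symm hz

theorem dt_apply {u v : J1 n π} (hv : v ∈ (chartAt (JetModel n) u).source)
    (ξ : TangentSpace 𝓘(ℝ, JetModel n) v) :
    dt π v ξ = (differential (chartAt (JetModel n) u) v ξ).1.1 := by
  have h := differential_eq_fderiv hv (contMDiff_proj_pt.mdifferentiableAt (by simp)) ξ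
  have h1 : (fun u : J1 n π => π u.pt) ∘ (chartAt (JetModel n) u).symm =ᶠ[
      𝓝 (chartAt (JetModel n) u v)] fun z => z.1.1 := by
    filter_upwards [(chartAt (JetModel n) u).open_target.mem_nhds
      ((chartAt (JetModel n) u).map_source hv)] with z hz
    exact proj_pt_chart_symm hz
  refine h.trans ?_
  rw [h1.fderiv_eq]
  rw [(hasFDerivAt_fst (𝕜 := ℝ) (p := chartAt (JetModel n) u v)).fst.fderiv]
  rfl

/-- The coordinate vectors `∂/∂yⁱ` are vertical. -/
theorem isVertical_tangentParam {u : J1 n π} {z : JetModel n}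
    (hz : z ∈ (chartAt (JetModel n) u).target) (η : Euc n) :
    IsVertical (tangentParam (E := JetModel n) (chartAt (JetModel n) u).symm z (0, η)) := by
  have h0 := isAdapted_adaptedChartAt (n := n) (π := π) u.pt
  have h1 : J1.pt ∘ (chartAt (JetModel n) u).symm =ᶠ[𝓝 z]
      (adaptedChartAt (n := n) π u.pt).symm ∘ Prod.fst := by
    filter_upwards [(chartAt (JetModel n) u).open_target.mem_nhds hz] with w hw
    have hw' : ((chartAt (JetModel n) u).symm w).pt ∈ (adaptedChartAt (n := n) π u.pt).source :=
      (chartAt (JetModel n) u).map_target hw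
    have h2 : adaptedChartAt (n := n) π u.pt ((chartAt (JetModel n) u).symm w).pt = w.1 :=
      congrArg Prod.fst ((chartAt (JetModel n) u).right_inv hw)
    simp only [Function.comp_apply]
    rw [← h2, (adaptedChartAt (n := n) π u.pt).left_inv hw']
  have h3 := mfderiv_comp z (contMDiff_pt.mdifferentiableAt (by simp))
    ((mdifferentiable_chart (I := 𝓘(ℝ, JetModel n)) u).mdifferentiableAt_symm hz)
  have h4 := mfderiv_comp (I' := 𝓘(ℝ, BaseModel n)) z (h0.mdifferentiableAt_symm hz)
    (differentiableAt_fst (𝕜 := ℝ) (p := z)).mdifferentiableAt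
  rw [h1.mfderiv_eq, h4, mfderiv_eq_fderiv, fderiv_fst] at h3
  refine (DFunLike.congr_fun h3 ((0 : BaseModel n), η)).symm.trans ?_
  exact map_zero (mfderiv 𝓘(ℝ, BaseModel n) (𝓡 (n + 1)) (adaptedChartAt (n := n) π u.pt).symm z.1)

/-- Vertical vectors have no component along the base: the first component of the chart at `u` is
the adapted chart of `M` composed with `π₁₀`. -/
theorem IsVertical.fst_eq_zero {u : J1 n π} {ξ : TangentSpace 𝓘(ℝ, JetModel n) u}
    (hξ : IsVertical ξ) : (show JetModel n from ξ).1 = 0 := by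
  have h0 := isAdapted_adaptedChartAt (n := n) (π := π) u.pt
  have hu : u.pt ∈ (adaptedChartAt (n := n) π u.pt).source := mem_chart_source (JetModel n) u
  have h1 := mfderiv_comp u (h0.mdifferentiableAt hu)
    (contMDiff_pt.mdifferentiableAt (by simp) : MDifferentiableAt 𝓘(ℝ, JetModel n) _ _ u)
  have h2 := mfderiv_comp (I' := 𝓘(ℝ, JetModel n)) (I'' := 𝓘(ℝ, BaseModel n)) u
    (differentiableAt_fst (𝕜 := ℝ) (p := chartAt (JetModel n) u u)).mdifferentiableAt
    ((mdifferentiable_chart (I := 𝓘(ℝ, JetModel n)) u).mdifferentiableAt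
      (mem_chart_source (JetModel n) u))
  rw [mfderiv_eq_fderiv, fderiv_fst] at h2
  have h3 : Prod.fst ∘ chartAt (JetModel n) u = adaptedChartAt (n := n) π u.pt ∘ J1.pt := rfl
  rw [h3, h1] at h2
  have h4 := DFunLike.congr_fun h2 ξ
  have h5 : (differential (chartAt (JetModel n) u) u ξ).1 = 0 := by
    refine h4.symm.trans ?_
    refine (congrArg (mfderiv (𝓡 (n + 1)) 𝓘(ℝ, BaseModel n) (adaptedChartAt (n := n) π u.pt)
      u.pt) hξ).trans ?_
    exact map_zero _
  rwa [differential_chart_self] at h5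

theorem IsVertical.dt_eq_zero {u : J1 n π} {ξ : TangentSpace 𝓘(ℝ, JetModel n) u}
    (hξ : IsVertical ξ) : dt π u ξ = 0 := by
  rw [dt_apply (mem_chart_source _ u), differential_chart_self]
  exact congrArg Prod.fst hξ.fst_eq_zero

theorem IsVertical.verticalEndomorphism_eq_zero {u : J1 n π}
    {ξ : TangentSpace 𝓘(ℝ, JetModel n) u} (hξ : IsVertical ξ) : verticalEndomorphism u ξ = 0 := by
  have h := hξ.fst_eq_zero
  obtain ⟨a, η⟩ := ξ
  obtain rfl : a = 0 := h
  exact (modelJ_apply (chartAt (JetModel n) u u).2 0 0 η).trans (by simp; rfl)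

theorem differential_chart_verticalEndomorphism {u v : J1 n π}
    (hv : v ∈ (chartAt (JetModel n) u).source) (ξ : TangentSpace 𝓘(ℝ, JetModel n) v) :
    differential (chartAt (JetModel n) u) v (verticalEndomorphism v ξ) =
      modelJ (chartAt (JetModel n) u v).2 (differential (chartAt (JetModel n) u) v ξ) :=
  differential_verticalEndomorphism (isAdapted_adaptedChartAt (n := n) (π := π) u.pt) u v hv ξ

/-- In coordinates, the base component of a semispray `∂/∂t + yⁱ ∂/∂xⁱ + fⁱ ∂/∂yⁱ` is `(1, y)`. -/
theorem IsSemispray.vecInChart_fst {S : VectorField (JetModel n) (J1 n π)} (hS : IsSemispray S)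
    {u : J1 n π} {z : JetModel n} (hz : z ∈ (chartAt (JetModel n) u).target) :
    (vecInChart S u z).1 = (1, z.2) := by
  have hv := (chartAt (JetModel n) u).map_target hz
  have h1 := (dt_apply hv (S _)).symm.trans (hS.dt_eq_one _)
  have h2 := differential_chart_verticalEndomorphism hv (S ((chartAt (JetModel n) u).symm z))
  rw [hS.verticalEndomorphism_eq_zero, map_zero] at h2
  have h3 : (0 : JetModel n) = modelJ (chartAt (JetModel n) u ((chartAt (JetModel n) u).symm z)).2
    (vecInChart S u z) := h2
  rw [(chartAt (JetModel n) u).right_inv hz] at h3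
  have h4 : (vecInChart S u z).1.1 = 1 := h1
  have h5 : (0 : Euc n) = (vecInChart S u z).1.2 - (vecInChart S u z).1.1 • z.2 :=
    congrArg Prod.snd h3
  rw [h4, one_smul] at h5
  exact Prod.ext h4 (sub_eq_zero.1 h5.symm)

theorem IsSemiBasicOn.inChart_vertical {θ : OneForm (JetModel n) (J1 n π)} {U : Set (J1 n π)}
    (hθ : IsSemiBasicOn θ U) {u : J1 n π} {z : JetModel n}
    (hz : z ∈ (chartAt (JetModel n) u).target) (hzU : (chartAt (JetModel n) u).symm z ∈ U)
    (η : Euc n) : inChart θ u z (0, η) = 0 :=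
  hθ.apply_vertical _ hzU _ (isVertical_tangentParam hz η)

/-- For semi-basic `θ`, `i_J L_S θ = θ - θ(S) dt`. In coordinates, with
`θ = θ₀ dt + θᵢ (dxⁱ - yⁱ dt)`, the `dyⁱ` component of `L_S θ` is `θᵢ`. -/
theorem IsSemiBasicOn.lieDerivative_verticalEndomorphism {θ : OneForm (JetModel n) (J1 n π)}
    {U : Set (J1 n π)} (hθ : IsSemiBasicOn θ U) (hU : IsOpen U)
    {S : VectorField (JetModel n) (J1 n π)} (hS : IsSemispray S) {v : J1 n π} (hv : v ∈ U)
    (ξ : TangentSpace 𝓘(ℝ, JetModel n) v) :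
    lieDerivative S θ v (verticalEndomorphism v ξ) = θ v ξ - θ v (S v) * dt π v ξ := by
  have hvs := mem_chart_source (JetModel n) v
  have hvt := mem_chart_target (JetModel n) v
  set z := chartAt (JetModel n) v v
  set Θ := inChart θ v
  set X := vecInChart S v
  have hΘ : DifferentiableAt ℝ Θ z :=
    (hθ.smooth.contDiffAt_inChart hU hvs hv).differentiableAt (by simp)
  have hX : DifferentiableAt ℝ X z :=
    (contDiffAt_vecInChart hS.smooth hvs).differentiableAt (by simp)
  have hnear : (chartAt (JetModel n) v).target ∩ (chartAt (JetModel n) v).symm ⁻¹' U ∈ 𝓝 z :=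
    ((chartAt (JetModel n) v).symm.isOpen_inter_preimage hU).mem_nhds ⟨hvt, by simpa [z] using hv⟩
  have hvert : ∀ η : Euc n, Θ z (0, η) = 0 := fun η =>
    hθ.inChart_vertical hvt (by simpa [z] using hv) η
  -- Differentiate the identities `Θ (0, η) = 0` and `X = ((1, y), f)`.
  have hdΘ : ∀ (w : JetModel n) (η : Euc n), fderiv ℝ Θ z w (0, η) = 0 := by
    intro w η
    have h1 : (fun z => Θ z ((0 : BaseModel n), η)) =ᶠ[𝓝 z] fun _ => (0 : ℝ) := by
      filter_upwards [hnear] with z' hz'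
      exact hθ.inChart_vertical hz'.1 hz'.2 η
    have h2 := (hΘ.hasFDerivAt.clm_apply (hasFDerivAt_const ((0 : BaseModel n), η) z)).fderiv
    rw [h1.fderiv_eq] at h2
    simpa using (DFunLike.congr_fun h2 w).symm
  have hdX : ∀ η : Euc n, (fderiv ℝ X z (0, η)).1 = (0, η) := by
    intro η
    have h1 : (fun z => (X z).1) =ᶠ[𝓝 z] fun z => ((1 : ℝ), z.2) := by
      filter_upwards [hnear] with z' hz'
      exact hS.vecInChart_fst hz'.1
    have h2 := hX.hasFDerivAt.fst.fderiv
    have h3 := (hasFDerivAt_const (1 : ℝ) z).prodMk (hasFDerivAt_snd (𝕜 := ℝ) (p := z))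
    rw [h1.fderiv_eq, h3.fderiv] at h2
    simpa using (DFunLike.congr_fun h2 ((0 : BaseModel n), η)).symm
  have hbase : ∀ w : JetModel n, Θ z w = Θ z (w.1, 0) := by
    intro w
    have h1 : w = (w.1, 0) + (0, w.2) := by simp
    conv_lhs => rw [h1, map_add, hvert, add_zero]
  -- The terms with `(D_η Θ)(X)` cancel in Cartan's formula, and `Θ (D_η X)` remains.
  have hlie : ∀ η : Euc n, inChart (lieDerivative S θ) v z (0, η) = Θ z ((0, η), 0) := by
    intro η
    rw [inChart_lieDerivative hθ.smooth hU hS.smooth hvt (by simpa [z] using hv)]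
    have h1 := (hΘ.hasFDerivAt.clm_apply hX.hasFDerivAt).fderiv
    rw [h1]
    change Θ z (fderiv ℝ X z (0, η)) + fderiv ℝ Θ z (0, η) (X z) + fderiv ℝ Θ z (X z) (0, η) -
      fderiv ℝ Θ z (0, η) (X z) = _
    rw [hdΘ, hbase (fderiv ℝ X z (0, η)), hdX]
    ring
  have hself : ∀ α : OneForm (JetModel n) (J1 n π), ∀ ζ : TangentSpace 𝓘(ℝ, JetModel n) v,
      α v ζ = inChart α v z ζ := by
    intro α ζ
    rw [oneForm_apply_eq_inChart α hvs, differential_chart_self]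
  have hSv : (show JetModel n from S v).1 = (1, z.2) := by
    have h1 := hS.vecInChart_fst hvt
    rwa [vecInChart_chart S hvs, differential_chart_self] at h1
  obtain ⟨⟨t, x⟩, y⟩ := ξ
  have hJ : verticalEndomorphism v ((t, x), y) = ((0 : BaseModel n), x - t • z.2) :=
    modelJ_apply _ _ _ _
  have e1 : lieDerivative S θ v (verticalEndomorphism v ((t, x), y)) =
      Θ z ((0, x - t • z.2), 0) :=
    (congrArg (lieDerivative S θ v) hJ).trans ((hself _ _).trans (hlie _))
  have e2 : θ v ((t, x), y) = Θ z ((t, x), 0) := (hself θ _).trans (hbase _)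
  have e3 : θ v (S v) = Θ z ((1, z.2), 0) :=
    (hself θ _).trans ((hbase (S v)).trans (congrArg (fun a : BaseModel n => Θ z (a, 0)) hSv))
  have e4 : dt π v ((t, x), y) = t := by
    have h := dt_apply hvs (show TangentSpace 𝓘(ℝ, JetModel n) v from ((t, x), y))
    rw [differential_chart_self] at h
    exact h
  rw [e1, e2, e3, e4]
  have h1 : (((0 : ℝ), x - t • z.2), (0 : Euc n)) = ((t, x), 0) - t • (((1 : ℝ), z.2), 0) := by simp
  rw [h1, map_sub, map_smul, smul_eq_mul, mul_comm]

theorem poincareCartan_apply_semispray {S : VectorField (JetModel n) (J1 n π)} (hS : IsSemispray S)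
    (L : J1 n π → ℝ) (u : J1 n π) : poincareCartan L u (S u) = L u := by
  change L u * dt π u (S u) + differential L u (verticalEndomorphism u (S u)) = L u
  rw [hS.dt_eq_one, hS.verticalEndomorphism_eq_zero, map_zero, mul_one, add_zero]

theorem isSemiBasicOn_poincareCartan {L : J1 n π → ℝ} {U : Set (J1 n π)} (hU : IsOpen U)
    (hL : ContMDiffOn 𝓘(ℝ, JetModel n) 𝓘(ℝ, ℝ) ∞ L U) : IsSemiBasicOn (poincareCartan L) U := by
  constructor
  · intro u hu
    refine ((contMDiffAt_oneForm_iff (poincareCartan L) u).2 ?_).contMDiffWithinAt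
    have hus := mem_chart_source (JetModel n) u
    have hLu := hL.contMDiffAt (hU.mem_nhds hu)
    have h1 := (contMDiffAt_comp_chart_iff hus).1 hLu
    have h2 := contDiffAt_inChart_differential hus (contMDiff_proj_pt (n := n) (π := π)).contMDiffAt
    have h3 := contDiffAt_inChart_differential hus hLu
    have h4 : ContDiff ℝ ∞ fun z : JetModel n => modelJ z.2 := by
      unfold modelJ
      fun_prop
    refine ((h1.smul h2).add (h3.clm_comp h4.contDiffAt)).congr_of_eventuallyEq ?_
    filter_upwards [(chartAt (JetModel n) u).open_target.mem_nhds (mem_chart_target _ u)] with z hz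
    have hv := (chartAt (JetModel n) u).map_target hz
    refine ContinuousLinearMap.ext fun e => ?_
    have h5 := oneForm_apply_eq_inChart (differential L) hv (verticalEndomorphism _
      (tangentParam (E := JetModel n) (chartAt (JetModel n) u).symm z e))
    rw [differential_chart_verticalEndomorphism hv, differential_chart_tangentParam hz,
      (chartAt (JetModel n) u).right_inv hz] at h5
    exact congrArg (_ + ·) h5
  · intro u _ ξ hξ
    change L u * dt π u ξ + differential L u (verticalEndomorphism u ξ) = 0
    rw [hξ.dt_eq_zero, hξ.verticalEndomorphism_eq_zero, map_zero, mul_zero, add_zero]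

end JetForms

/-! ### Lagrangians and semi-basic forms -/

section InverseProblem

variable {n : ℕ} {M : Type*} [TopologicalSpace M] [ChartedSpace (Euc (n + 1)) M]
  [IsManifold (𝓡 (n + 1)) ∞ M] {π : M → ℝ} [IsFibred n π]
  {S : VectorField (JetModel n) (J1 n π)}

/-- For a semispray `S` and a Lagrangian with `L_S θ_L = dL` one has `θ_L(S) = L`, hence
`i_S dθ_L = L_S θ_L - dL = 0`. -/
theorem contract_extDeriv₁_poincareCartan_eq_zero (hS : IsSemispray S) {L : J1 n π → ℝ}
    {v : J1 n π} (h : lieDerivative S (poincareCartan L) v = differential L v) :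
    contract S (extDeriv₁ (poincareCartan L)) v = 0 := by
  have h1 : (fun w => poincareCartan L w (S w)) = L := funext (poincareCartan_apply_semispray hS L)
  unfold lieDerivative at h
  rw [h1] at h
  exact left_eq_add.1 h.symm

/-- The Poincaré-Cartan form of a regular Lagrangian for `S` is a non-degenerate semi-basic form
with closed Lie derivative. -/
theorem SatisfiesEulerLagrangeOn.semiBasic_poincareCartan (hS : IsSemispray S) {L : J1 n π → ℝ}
    {W : Set (J1 n π)} (hW : IsOpen W) (hL : IsRegularLagrangianOn L W)
    (hEL : SatisfiesEulerLagrangeOn S L W) :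
    IsSemiBasicOn (poincareCartan L) W ∧ IsNondegenerateOn S (poincareCartan L) W ∧
      ∀ v ∈ W, extDeriv₁ (lieDerivative S (poincareCartan L)) v = 0 := by
  refine ⟨isSemiBasicOn_poincareCartan hW hL.smooth, fun u hu => ?_, fun v hv => ?_⟩
  · have h0 : wedge (contract S (extDeriv₁ (poincareCartan L))) (dt π) u = 0 := by
      unfold wedge
      rw [contract_extDeriv₁_poincareCartan_eq_zero hS (hEL u hu)]
      ext ξ η
      simp
    have h1 : (extDeriv₁ (poincareCartan L) + wedge (contract S (extDeriv₁ (poincareCartan L)))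
        (dt π)) u = extDeriv₁ (poincareCartan L) u := by
      rw [Pi.add_apply, h0]
      exact add_zero (extDeriv₁ (poincareCartan L) u)
    unfold rankAt
    rw [h1]
    exact hL.rank_eq u hu
  · rw [extDeriv₁_congr (Filter.eventually_of_mem (hW.mem_nhds hv) hEL)]
    exact extDeriv₁_differential (hL.smooth.contMDiffAt (hW.mem_nhds hv))

/-- If `θ` is semi-basic and `L_S θ = dL`, then `θ_L = θ + (L - θ(S)) dt`. -/
theorem poincareCartan_eq_of_lieDerivative_eq (hS : IsSemispray S)
    {θ : OneForm (JetModel n) (J1 n π)} {W : Set (J1 n π)} (hW : IsOpen W)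
    (hθ : IsSemiBasicOn θ W) {L : J1 n π → ℝ} {v : J1 n π} (hv : v ∈ W)
    (hL : differential L v = lieDerivative S θ v) :
    poincareCartan L v = θ v + (L v - θ v (S v)) • dt π v := by
  ext ξ
  change L v * dt π v ξ + differential L v (verticalEndomorphism v ξ) =
    θ v ξ + (L v - θ v (S v)) * dt π v ξ
  rw [hL, hθ.lieDerivative_verticalEndomorphism hW hS hv]
  ring

/-- A local primitive `L` of `L_S θ`, for `θ` semi-basic and non-degenerate, is a regular Lagrangian
for `S`: with `g = L - θ(S)` one has `dg = i_S dθ`, so that `dθ_L = dθ + dg ∧ dt` is exactly the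
2-form in the definition of non-degeneracy. -/
theorem isRegularLagrangianOn_of_differential_eq_lieDerivative (hS : IsSemispray S)
    {θ : OneForm (JetModel n) (J1 n π)} {V : Set (J1 n π)} (hV : IsOpen V)
    (hθ : IsSemiBasicOn θ V) (hnd : IsNondegenerateOn S θ V) {L : J1 n π → ℝ}
    (hLs : ContMDiffOn 𝓘(ℝ, JetModel n) 𝓘(ℝ, ℝ) ∞ L V)
    (hL : ∀ v ∈ V, differential L v = lieDerivative S θ v) :
    IsRegularLagrangianOn L V ∧ SatisfiesEulerLagrangeOn S L V := by
  have hdg : ∀ v ∈ V, differential (fun w => L w - θ w (S w)) v = contract S (extDeriv₁ θ) v := by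
    intro v hv
    have h1 : MDifferentiableAt 𝓘(ℝ, JetModel n) 𝓘(ℝ, ℝ) L v :=
      (hLs.contMDiffAt (hV.mem_nhds hv)).mdifferentiableAt (by simp)
    have h2 : MDifferentiableAt 𝓘(ℝ, JetModel n) 𝓘(ℝ, ℝ) (fun w => θ w (S w)) v :=
      (hθ.smooth.contMDiffAt_apply hV hS.smooth hv).mdifferentiableAt (by simp)
    have h3 : differential (fun w => L w - θ w (S w)) v =
        differential L v - differential (fun w => θ w (S w)) v :=
      (h1.hasMFDerivAt.sub h2.hasMFDerivAt).mfderiv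
    rw [h3, hL v hv]
    exact add_sub_cancel_left _ _
  have hdθ : ∀ v ∈ V, extDeriv₁ (poincareCartan L) v =
      (extDeriv₁ θ + wedge (contract S (extDeriv₁ θ)) (dt π)) v := by
    intro v hv
    have h1 : ∀ᶠ w in 𝓝 v, poincareCartan L w =
        θ w + (L w - θ w (S w)) • differential (fun u : J1 n π => π u.pt) w := by
      filter_upwards [hV.mem_nhds hv] with w hw
      exact poincareCartan_eq_of_lieDerivative_eq hS hV hθ hw (hL w hw)
    rw [extDeriv₁_congr h1, extDeriv₁_add_smul_differential
      ((hθ.smooth.contDiffAt_inChart hV (mem_chart_source _ v) hv).differentiableAt (by simp))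
      ((hLs.contMDiffAt (hV.mem_nhds hv)).sub
        (hθ.smooth.contMDiffAt_apply hV hS.smooth hv)) contMDiff_proj_pt.contMDiffAt]
    unfold wedge
    rw [hdg v hv]
    rfl
  refine ⟨⟨hLs, fun u hu => ?_⟩, fun v hv => ?_⟩
  · have h := hnd u hu
    unfold rankAt at h ⊢
    rwa [hdθ u hu]
  · have h1 : (fun w => poincareCartan L w (S w)) = L :=
      funext (poincareCartan_apply_semispray hS L)
    unfold lieDerivative
    rw [h1]
    refine add_eq_left.2 (ContinuousLinearMap.ext fun ξ => ?_)
    unfold contract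
    rw [hdθ v hv]
    change extDeriv₁ θ v (S v) ξ + (extDeriv₁ θ v (S v) (S v) * dt π v ξ -
      dt π v (S v) * extDeriv₁ θ v (S v) ξ) = 0
    rw [extDeriv₁_apply_self, hS.dt_eq_one]
    ring

/-- A non-degenerate semi-basic form with closed Lie derivative makes `S` Lagrangian: near each
point, a primitive of the Lie derivative is a regular Lagrangian. -/
theorem isLagrangianOver_of_semiBasic (hS : IsSemispray S)
    {θ : OneForm (JetModel n) (J1 n π)} {W : Set (J1 n π)} (hW : IsOpen W)
    (hθ : IsSemiBasicOn θ W) (hnd : IsNondegenerateOn S θ W)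
    (hclosed : ∀ v ∈ W, extDeriv₁ (lieDerivative S θ) v = 0) : IsLagrangianOver S W := by
  intro u hu
  obtain ⟨V, hVW, hV, huV, L, hLs, hL⟩ := exists_differential_eq_of_extDeriv₁_eq_zero hW hu
    (fun v hv => hθ.smooth.contDiffAt_inChart_lieDerivative hW hS.smooth hv.1 hv.2) hclosed
  exact ⟨V, hV, huV, L, isRegularLagrangianOn_of_differential_eq_lieDerivative hS hV
    ⟨hθ.smooth.mono hVW, fun v hv => hθ.apply_vertical v (hVW hv)⟩
    (fun v hv => hnd v (hVW hv)) hLs hL⟩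

end InverseProblem

end JetBundle

end

theorem theorem4p5 {n : ℕ} {M : Type*} [TopologicalSpace M]
    [ChartedSpace (EuclideanSpace ℝ (Fin (n + 1))) M] [IsManifold (𝓡 (n + 1)) ∞ M]
    (π : M → ℝ) [IsFibred n π]
    (S : VectorField (JetModel n) (J1 n π)) (hS : IsSemispray S) :
    (IsLagrangianVectorField S ↔
      ∀ u : J1 n π, ∃ U : Set (J1 n π), IsOpen U ∧ u ∈ U ∧
        ∃ θ : OneForm (JetModel n) (J1 n π), IsSemiBasicOn θ U ∧ IsNondegenerateOn S θ U ∧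
          ∀ v ∈ U, extDeriv₁ (lieDerivative S θ) v = 0) ∧
    (∀ W : Set (J1 n π), IsOpen W →
      (∃ θ : OneForm (JetModel n) (J1 n π), IsSemiBasicOn θ W ∧ IsNondegenerateOn S θ W ∧
        ∀ v ∈ W, extDeriv₁ (lieDerivative S θ) v = 0) →
      IsLagrangianOver S W) ∧
    (∀ W : Set (J1 n π), IsOpen W →
      (∃ L : J1 n π → ℝ, IsRegularLagrangianOn L W ∧ SatisfiesEulerLagrangeOn S L W) →
      ∃ θ : OneForm (JetModel n) (J1 n π), IsSemiBasicOn θ W ∧ IsNondegenerateOn S θ W ∧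
        ∀ v ∈ W, extDeriv₁ (lieDerivative S θ) v = 0) := by
  refine ⟨⟨fun h u => ?_, fun h u _ => ?_⟩, fun W hW => ?_, fun W hW => ?_⟩
  · obtain ⟨U, hU, hu, L, hL, hEL⟩ := h u (Set.mem_univ u)
    exact ⟨U, hU, hu, poincareCartan L, hEL.semiBasic_poincareCartan hS hU hL⟩
  · obtain ⟨U, hU, hu, θ, hθ, hnd, hclosed⟩ := h u
    exact isLagrangianOver_of_semiBasic hS hU hθ hnd hclosed u hu
  · rintro ⟨θ, hθ, hnd, hclosed⟩
    exact isLagrangianOver_of_semiBasic hS hW hθ hnd hclosed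
  · rintro ⟨L, hL, hEL⟩
    exact ⟨poincareCartan L, hEL.semiBasic_poincareCartan hS hW hL⟩
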